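/- **Setting.** Let $\Phi$ be a stationary simple point process on $\mathbb{R}^2$ (a random locally finite set of points), defined on a probability space $(\Omega,\mathcal A,\mathbb P)$; $\Phi(L)$ is the number of its points in $L$, $b(o,r)$ and $B(o,r)$ are the open and closed disks of radius $r$ centred at the origin. $\Phi$ is *strongly $(\sigma,\rho,\nu)$-ball regulated* ($\sigma,\nu\ge 0$, $\rho\in\mathbb R$) if for every $r\ge 0$, $\Phi(b(o,r))\le\sigma+\rho r+\nu r^2$ $\mathbb P$-a.s., and *strongly $\tau$-void regulated* ($\tau>0$) if $\Phi(B(o,\tau))\ge 1$ $\mathbb P$-a.s. Let $\ell:[0,\infty)\to(0,\infty)$ be a non-increasing path loss function with $\int_0^\infty r\,\ell(r)\,dr<\infty$ and let $W\ge 0$ be the noise variance. Given fading variables $h_{xy}\ge 0$ for the ordered pairs $x\ne y$ of points of $\Phi$, put $$\mathrm{SINR}_{xy}=\frac{h_{xy}\,\ell(\|x-y\|)}{\sum_{z\in\Phi\setminus\{x,y\}}h_{zy}\,\ell(\|z-y\|)+W}.$$ For $\theta>0$, the *SINR graph* has the points of $\Phi$ as nodes and an edge between $x\neq y$ when $\mathrm{SINR}_{xy}>\theta$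 and $\mathrm{SINR}_{yx}>\theta$. It *percolates* if it has an infinite connected component. Without fading means $h_{xy}=1$ for all $x\ne y$. With fading means that the $h_{xy}$ are i.i.d. and independent of $\Phi$, are not a.s. zero, and have exponential moments: there is $s^*>0$ with $\mathbb E\,e^{s h_{xy}}<\infty$ for $s\in[0,s^*)$. The SINR graph has a *north-south and east-west backbone* if there is $s>0$ such that, almost surely under the Palm probability $\mathbb P^o_\Phi$ of $\Phi$, there are points $\{x_{i,j}\}_{i,j\in\mathbb Z}$ of $\Phi$ such that $x_{0,0}=(0,0)$, each $x_{i,j}$ belongs to the closed square of centre $(2is,2js)$ and side $2s$, and for all $i,j\in\mathbb Z$ there are edges between $x_{i,j}$ and $x_{i\pm1,j}$ and between $x_{i,j}$ and $x_{i,j\pm1}$. **Lemma.** Suppose that $\Phi$ is strongly $(\sigma,\rho,\nu)$-ball regulated and strongly $\tau$-void regulated. 1. Without fading, there is $\theta_0>0$ such that for every $\theta\in(0,\theta_0)$ the SINR graph has a north-south and east-west backbone. 2. With fading, there is $\theta_0>0$ such that for every $\theta\in(0,\theta_0)$ the SINR graph percolates $\mathbb P$-almost surely. -/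

import Mathlib

open MeasureTheory ProbabilityTheory
open scoped NNReal ENNReal

namespace SpatialNetwork

/-- The Euclidean plane. -/
abbrev Plane : Type := EuclideanSpace ℝ (Fin 2)

/-! ### Locally finite configurations and simple point processes -/

/-- A locally finite set of points of the plane: a realization of a simple point process. -/
structure Config : Type where
  points : Set Plane
  locallyFinite : ∀ B : Set Plane, Bornology.IsBounded B → (points ∩ B).Finite

namespace Config

/-- The counting measure `∑_{x ∈ φ} δ_x` of a configuration `φ`. -/
noncomputable def toMeasure (φ : Config) : Measure Plane :=
  Measure.count.restrict φ.points

/-- The number `φ(B)` of points of `φ` in `B` (finite when `B` is bounded). -/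
noncomputable def card (φ : Config) (B : Set Plane) : ℕ := (φ.points ∩ B).ncard

/-- The usual σ-algebra on configurations: the one generated by the counts `φ ↦ φ(B)`, `B` Borel. -/
noncomputable instance : MeasurableSpace Config := MeasurableSpace.comap toMeasure inferInstance

/-- The configuration `φ + t`. -/
def translate (φ : Config) (t : Plane) : Config where
  points := (fun x => x + t) '' φ.points
  locallyFinite := by
    intro B hB
    have h1 : ((fun x => x - t) '' B) = (fun x => x + (-t)) '' B := by
      simp only [sub_eq_add_neg]
    have hB' : Bornology.IsBounded ((fun x => x - t) '' B) := by
      rw [h1, Set.image_add_right, neg_neg]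
      have := (isometry_add_right t).antilipschitz.isBounded_preimage hB
      exact this
    refine ((φ.locallyFinite _ hB').image (fun x => x + t)).subset ?_
    rintro y ⟨⟨x, hx, rfl⟩, hy⟩
    exact ⟨x, ⟨hx, ⟨x + t, hy, by simp⟩⟩, rfl⟩

end Config

/-- `Φ` is a (simple) point process on the plane. -/
def IsPointProcess {Ω : Type*} [MeasurableSpace Ω] (Φ : Ω → Config) : Prop := Measurable Φ

/-- Stationarity: the law of `Φ + t` does not depend on `t`. -/
def IsStationary {Ω : Type*} [MeasurableSpace Ω] (P : Measure Ω) (Φ : Ω → Config) : Prop :=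
  ∀ t : Plane, P.map (fun ω => (Φ ω).translate t) = P.map Φ

/-- Strong `(σ, ρ, ν)`-ball regulation: for every `r ≥ 0`, almost surely the open ball of radius
`r` around the origin contains at most `σ + ρ r + ν r ^ 2` points. -/
def StronglyBallRegulated {Ω : Type*} [MeasurableSpace Ω] (P : Measure Ω) (Φ : Ω → Config)
    (σ ρ ν : ℝ) : Prop :=
  0 ≤ σ ∧ 0 ≤ ν ∧ ∀ r : ℝ, 0 ≤ r →
    ∀ᵐ ω ∂P, ((Φ ω).card (Metric.ball 0 r) : ℝ) ≤ σ + ρ * r + ν * r ^ 2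

/-- Strong `τ`-void regulation: almost surely the closed ball of radius `τ > 0` around the origin
contains a point. -/
def StronglyVoidRegulated {Ω : Type*} [MeasurableSpace Ω] (P : Measure Ω) (Φ : Ω → Config)
    (τ : ℝ) : Prop :=
  0 < τ ∧ ∀ᵐ ω ∂P, 1 ≤ (Φ ω).card (Metric.closedBall 0 τ)

/-! ### The Palm probability -/

/-- The kernel `φ ↦ ∑_{x ∈ φ} δ_x`. -/
noncomputable def pointKernel : Kernel Config Plane where
  toFun := Config.toMeasure
  measurable' := comap_measurable _

/-- The half-open unit square `[0, 1) × [0, 1)`. -/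
def unitCell : Set Plane := {x | ∀ i, x i ∈ Set.Ico (0 : ℝ) 1}

/-- The intensity of a stationary law: the expected number of points in the unit square. -/
noncomputable def intensity (μ : Measure Config) : ℝ≥0∞ := ∫⁻ φ, φ.toMeasure unitCell ∂μ

/-- The Palm probability of a stationary law `μ` of intensity `0 < lam < ∞`:
`A ↦ lam⁻¹ * 𝔼 ∑_{x ∈ φ ∩ [0, 1)²} 1_A (φ - x)`, see `palm_apply`. It is obtained from the
Campbell measure `μ(dφ) ∑_{x ∈ φ} δ_x` by restriction to the unit square and by shifting the
point `x` to the origin. -/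
noncomputable def palm (μ : Measure Config) : Measure Config :=
  (intensity μ)⁻¹ •
    ((μ ⊗ₘ pointKernel).restrict (Set.univ ×ˢ unitCell)).map (fun p => p.1.translate (-p.2))

/-! The remaining facts of this section check that the Palm probability is given by the displayed
formula. -/

theorem Config.countable_points (φ : Config) : φ.points.Countable := by
  have : φ.points = ⋃ n : ℕ, φ.points ∩ Metric.closedBall 0 (n : ℝ) := by
    rw [← Set.inter_iUnion, Metric.iUnion_closedBall_nat, Set.inter_univ]
  rw [this]
  exact Set.countable_iUnion fun n =>
    (φ.locallyFinite _ Metric.isBounded_closedBall).countable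

theorem Config.toMeasure_lt_top (φ : Config) {B : Set Plane} (hB : MeasurableSet B)
    (hb : Bornology.IsBounded B) : φ.toMeasure B < ∞ := by
  rw [Config.toMeasure, Measure.restrict_apply hB, Measure.count_apply_lt_top, Set.inter_comm]
  exact φ.locallyFinite B hb

theorem measurableSet_unitCell : MeasurableSet unitCell := by
  have : unitCell = ⋂ i, (fun x : Plane => x i) ⁻¹' (Set.Ico (0 : ℝ) 1) := by
    ext x; simp [unitCell]
  rw [this]
  exact MeasurableSet.iInter fun i => (by fun_prop : Measurable fun x : Plane => x i)
    measurableSet_Ico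

instance : IsSFiniteKernel pointKernel := by
  classical
  let A : ℕ → Set Plane := disjointed fun n : ℕ => Metric.closedBall (0 : Plane) (n : ℝ)
  have hAm : ∀ n, MeasurableSet (A n) := fun n =>
    MeasurableSet.disjointed (fun i => Metric.isClosed_closedBall.measurableSet) n
  have hAb : ∀ n, Bornology.IsBounded (A n) := fun n =>
    Metric.isBounded_closedBall.subset (disjointed_subset _ n)
  have hAd : Pairwise (Function.onFun Disjoint A) := disjoint_disjointed _
  have hAu : ⋃ n, A n = Set.univ := by
    rw [iUnion_disjointed, Metric.iUnion_closedBall_nat]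
  let S : ℕ → ℕ → Set Config := fun n k => {φ | ⌊(φ.toMeasure (A n)).toReal⌋₊ = k}
  have hcm : ∀ n, Measurable fun φ : Config => φ.toMeasure (A n) := fun n =>
    Kernel.measurable_coe pointKernel (hAm n)
  have hS : ∀ n k, MeasurableSet (S n k) := fun n k =>
    (Nat.measurable_floor.comp (hcm n).ennreal_toReal) (measurableSet_singleton k)
  let K : ℕ × ℕ → Kernel Config Plane := fun p =>
    Kernel.piecewise (hS p.1 p.2) (pointKernel.restrict (hAm p.1)) 0
  have hfin : ∀ p, IsFiniteKernel (K p) := by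
    rintro ⟨n, k⟩
    refine ⟨⟨ENNReal.ofReal (k + 1), ENNReal.ofReal_lt_top, fun φ => ?_⟩⟩
    by_cases hφ : φ ∈ S n k
    · have h1 : K (n, k) φ Set.univ = φ.toMeasure (A n) := by
        simp only [K, Kernel.piecewise_apply, if_pos hφ, Kernel.restrict_apply,
          Measure.restrict_apply_univ]
        rfl
      rw [h1, ← ENNReal.ofReal_toReal (φ.toMeasure_lt_top (hAm n) (hAb n)).ne]
      refine ENNReal.ofReal_le_ofReal ?_
      have h2 : ⌊(φ.toMeasure (A n)).toReal⌋₊ = k := hφ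
      rw [← h2]
      exact (Nat.lt_floor_add_one _).le
    · simp [K, Kernel.piecewise_apply, if_neg hφ]
  have hsum : pointKernel = Kernel.sum K := by
    ext φ B hB
    rw [Kernel.sum_apply' _ _ hB, ENNReal.tsum_prod (f := fun n k => K (n, k) φ B)]
    have h1 : ∀ n, ∑' k, K (n, k) φ B = φ.toMeasure (B ∩ A n) := by
      intro n
      rw [tsum_eq_single ⌊(φ.toMeasure (A n)).toReal⌋₊]
      · have : φ ∈ S n ⌊(φ.toMeasure (A n)).toReal⌋₊ := rfl
        simp only [K, Kernel.piecewise_apply, if_pos this, Kernel.restrict_apply]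
        rw [Measure.restrict_apply hB]
        rfl
      · intro k hk
        have : φ ∉ S n k := fun h => hk (Eq.symm h)
        simp [K, Kernel.piecewise_apply, if_neg this]
    simp only [h1]
    rw [← measure_iUnion (fun i j hij => (hAd hij).mono Set.inter_subset_right
      Set.inter_subset_right) (fun n => hB.inter (hAm n)), ← Set.inter_iUnion, hAu,
      Set.inter_univ]
    rfl
  rw [hsum]
  infer_instance

theorem Config.toMeasure_translate (φ : Config) (t : Plane) :
    (φ.translate t).toMeasure = φ.toMeasure.map (fun x => x + t) := by
  ext B hB
  have hφ := φ.countable_points.measurableSet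
  rw [Measure.map_apply (by fun_prop) hB, Config.toMeasure, Config.toMeasure,
    Measure.restrict_apply hB, Measure.restrict_apply (hB.preimage (by fun_prop)),
    Measure.count_apply (hB.inter (φ.translate t).countable_points.measurableSet),
    Measure.count_apply ((hB.preimage (by fun_prop)).inter hφ)]
  have : B ∩ (φ.translate t).points
      = (fun x => x + t) '' ((fun x => x + t) ⁻¹' B ∩ φ.points) := by
    rw [Set.image_preimage_inter]; rfl
  rw [this, (add_left_injective t).encard_image]

theorem measurable_shift : Measurable fun p : Config × Plane => p.1.translate (-p.2) := by
  let κ : Kernel (Config × Plane) Plane :=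
    pointKernel.comap (Prod.fst : Config × Plane → Config) measurable_fst
  refine measurable_comap_iff.2 (Measure.measurable_of_measurable_coe _ fun B hB => ?_)
  have h : ∀ p : Config × Plane, (p.1.translate (-p.2)).toMeasure B
      = ∫⁻ y, B.indicator 1 (y - p.2) ∂(κ p) := by
    intro p
    rw [Config.toMeasure_translate, Measure.map_apply (by fun_prop) hB,
      show κ p = p.1.toMeasure from rfl,
      ← lintegral_indicator_one (hB.preimage (by fun_prop))]
    refine lintegral_congr fun y => ?_
    rw [sub_eq_add_neg]
    rfl
  simp only [Function.comp_def]
  rw [funext h]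
  refine Measurable.lintegral_kernel_prod_right
    (f := fun (p : Config × Plane) (y : Plane) => B.indicator (1 : Plane → ℝ≥0∞) (y - p.2)) ?_
  exact (measurable_one.indicator hB).comp (by fun_prop)

theorem palm_apply (μ : Measure Config) [SFinite μ] {A : Set Config} (hA : MeasurableSet A) :
    palm μ A = (intensity μ)⁻¹ *
      ∫⁻ φ, ∑' x : ↥(φ.points ∩ unitCell), A.indicator 1 (φ.translate (-x)) ∂μ := by
  have hC := measurableSet_unitCell
  rw [palm, Measure.smul_apply, smul_eq_mul, Measure.map_apply measurable_shift hA,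
    Measure.restrict_apply (measurable_shift hA),
    Measure.compProd_apply ((measurable_shift hA).inter (MeasurableSet.univ.prod hC))]
  congr 1
  refine lintegral_congr fun φ => ?_
  have hm : Measurable fun x : Plane => φ.translate (-x) :=
    measurable_shift.comp measurable_prodMk_left
  have hφ := φ.countable_points.measurableSet
  have h1 : (Prod.mk φ ⁻¹' ((fun p : Config × Plane => p.1.translate (-p.2)) ⁻¹' A ∩
      Set.univ ×ˢ unitCell)) = ((fun x : Plane => φ.translate (-x)) ⁻¹' A) ∩ unitCell := by
    ext x; simp
  rw [h1]
  change φ.toMeasure _ = _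
  rw [Config.toMeasure, Measure.restrict_apply ((hm hA).inter hC), Set.inter_assoc,
    Set.inter_comm unitCell, ← Measure.restrict_apply (hm hA),
    ← lintegral_indicator_one (hm hA), ← lintegral_indicator (hφ.inter hC), lintegral_count,
    tsum_subtype (φ.points ∩ unitCell) (fun x => A.indicator 1 (φ.translate (-x)))]
  rfl

/-! ### The SINR graph -/

/-- A path loss function `ℓ : [0, ∞) → (0, ∞)`: positive, non-increasing (hence bounded by `ℓ 0`),
and integrable in the plane, that is, `∫_0^∞ r ℓ(r) dr < ∞`. -/
structure IsPathLoss (ℓ : ℝ → ℝ) : Prop where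
  pos : ∀ r, 0 ≤ r → 0 < ℓ r
  antitone : AntitoneOn ℓ (Set.Ici 0)
  integrable : IntegrableOn (fun r => r * ℓ r) (Set.Ioi 0)

section SINR

variable {ι : Type*} (ℓ : ℝ → ℝ) (W : ℝ≥0) (pos : ι → Plane) (g : ι → ι → ℝ≥0)

/-- Power received at the node `y` from the node `x`, when the nodes have the positions `pos` and
the fading from `x` to `y` is `g x y`. -/
noncomputable def power (x y : ι) : ℝ≥0∞ :=
  g x y * ENNReal.ofReal (ℓ (dist (pos x) (pos y)))

/-- Interference at the receiver `y` of the link `x → y`: the total power received at `y` from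
all nodes other than `x` and `y` (possibly infinite). -/
noncomputable def interference (x y : ι) : ℝ≥0∞ :=
  ∑' z : {z : ι // z ≠ x ∧ z ≠ y}, power ℓ pos g z y

/-- Signal to interference and noise ratio of the link `x → y`; `W` is the noise variance. -/
noncomputable def sinr (x y : ι) : ℝ≥0∞ :=
  power ℓ pos g x y / (interference ℓ pos g x y + W)

/-- The SINR graph for the threshold `θ`: two nodes are joined when the SINR exceeds `θ` in both
directions. -/
noncomputable def sinrGraph (θ : ℝ) : SimpleGraph ι where
  Adj x y := x ≠ y ∧ ENNReal.ofReal θ < sinr ℓ W pos g x y ∧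
    ENNReal.ofReal θ < sinr ℓ W pos g y x
  symm := ⟨fun _ _ h => ⟨h.1.symm, h.2.2, h.2.1⟩⟩
  loopless := ⟨fun _ h => h.1 rfl⟩

end SINR

/-- A graph percolates if it has an infinite connected component. -/
def Percolates {ι : Type*} (G : SimpleGraph ι) : Prop :=
  ∃ c : G.ConnectedComponent, c.supp.Infinite

/-- The SINR graph of the configuration `φ` without fading (all fading variables are `1`). -/
noncomputable def sinrGraphNoFading (ℓ : ℝ → ℝ) (W : ℝ≥0) (θ : ℝ) (φ : Config) :
    SimpleGraph φ.points :=
  sinrGraph ℓ W (fun x => (x : Plane)) (fun _ _ => 1) θ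

/-- The SINR graph without fading has a north-south and east-west backbone: for some `s > 0`,
almost surely under the Palm probability there are points `x i j` of the configuration,
`(i, j) ∈ ℤ²`, with `x 0 0` the origin and `x i j` in the (closed) square of center
`(2 i s, 2 j s)` and side `2 s`, such that `x i j` is joined to `x (i ± 1) j` and to
`x i (j ± 1)`. -/
def HasBackbone (μ : Measure Config) (ℓ : ℝ → ℝ) (W : ℝ≥0) (θ : ℝ) : Prop :=
  ∃ s : ℝ, 0 < s ∧ ∀ᵐ φ ∂(palm μ), ∃ x : ℤ → ℤ → φ.points,
    (x 0 0 : Plane) = 0 ∧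
    (∀ i j : ℤ, |(x i j : Plane) 0 - 2 * i * s| ≤ s ∧ |(x i j : Plane) 1 - 2 * j * s| ≤ s) ∧
    (∀ i j : ℤ,
      (sinrGraphNoFading ℓ W θ φ).Adj (x i j) (x (i + 1) j) ∧
      (sinrGraphNoFading ℓ W θ φ).Adj (x i j) (x (i - 1) j) ∧
      (sinrGraphNoFading ℓ W θ φ).Adj (x i j) (x i (j + 1)) ∧
      (sinrGraphNoFading ℓ W θ φ).Adj (x i j) (x i (j - 1)))

/-! ### Fading -/

/-- `X 0, X 1, …` is a measurable enumeration without repetition of the points of `Φ`. -/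
structure IsEnumeration {Ω : Type*} [MeasurableSpace Ω] (P : Measure Ω) (Φ : Ω → Config)
    (X : ℕ → Ω → Plane) : Prop where
  measurable : ∀ n, Measurable (X n)
  injective : ∀ᵐ ω ∂P, Function.Injective fun n => X n ω
  range_eq : ∀ᵐ ω ∂P, Set.range (fun n => X n ω) = (Φ ω).points

/-- The family `h m n`, `m ≠ n`, of fading variables from the node `X m` to the node `X n` is
i.i.d., independent of the positions of the nodes, not almost surely zero, and has exponential
moments. -/
structure IsFading {Ω : Type*} [MeasurableSpace Ω] (P : Measure Ω)
    (X : ℕ → Ω → Plane) (h : ℕ → ℕ → Ω → ℝ≥0) : Prop where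
  measurable : ∀ m n, Measurable (h m n)
  iIndep : iIndepFun (fun (p : {p : ℕ × ℕ // p.1 ≠ p.2}) => h p.1.1 p.1.2) P
  identDistrib : ∀ m n m' n', m ≠ n → m' ≠ n' → IdentDistrib (h m n) (h m' n') P P
  indep : IndepFun (fun ω n => X n ω)
    (fun ω (p : {p : ℕ × ℕ // p.1 ≠ p.2}) => h p.1.1 p.1.2 ω) P
  nonzero : ∀ m n, m ≠ n → ¬ ∀ᵐ ω ∂P, h m n ω = 0
  expMoments : ∃ s₀ : ℝ, 0 < s₀ ∧ ∀ s ∈ Set.Ico 0 s₀, ∀ m n, m ≠ n →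
    Integrable (fun ω => Real.exp (s * h m n ω)) P

end SpatialNetwork

/-!
Regularity. By stationarity, the two regulation properties hold around all points of a countable
dense set, so almost surely every open unit disk contains at most `N` points of `Φ` and every disk
of some fixed radius `R` contains a point (`IsRegular`, `ae_mem_regularConfigs`). For such a
configuration the total path loss `∑ ℓ(‖z - y‖)` received at any `y` is at most `N` times a
constant, which is finite because `r ℓ(r)` is integrable (`IsRegular.tsum_pathLoss_le`,
`latticePathLoss_lt_top`), and one can choose a point near each site of a square lattice.

Without fading. Regularity is translation invariant, so it holds almost surely for the Palm
probability, and there the origin is a point (`ae_palm_of_ae_mem_regularConfigs`). Points near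
neighbouring lattice sites are at bounded distance, hence the signal between them is bounded below
while the interference is bounded above, and they are joined for small `θ`.

With fading. The positions are independent of the fading variables, so they can be fixed at a
regular sequence (`exists_threshold_ae_percolates`). To each block `Q ∈ ℤ²` are attached `M` core
nodes, and to each pair of neighbouring blocks a terminal lying between them. Every fading variable
is owned by a single block, and the power received by a terminal is split between the two blocks
that share it. A block is good if one of its core nodes, the hub, has fading larger than `ε` to and
from the four terminals of the block, and if the power that its core nodes and terminals receive
through variables owned by the block is at most `K`. The goodness of different blocks depends on
disjoint sets of fading variables, so these events are independent. For large `M` and then large `K`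
a block is good with high probability (`measure_isBadBlock_le`), and for small `θ` the hubs of two
neighbouring good blocks are joined through the terminal between them (`reachable_of_good`).

It remains to see that a highly supercritical independent site percolation on `ℤ²` has an infinite
cluster. This is done by renormalization rather than by a contour argument: a block of side
`3 ^ (n + 1)` is bad if at least two of its nine sub-blocks of side `3 ^ n` are bad. A `3 × 3` grid
with one vertex removed is connected, and of the three pairs of sub-blocks facing each other across
the common side of two good blocks at least one consists of good sub-blocks; so the good parts of
neighbouring good blocks are connected at all scales (`blockCore_related`). The probability of being
bad is squared from one scale to the next, up to the factor `72`, so by Borel–Cantelli the large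
blocks with corner at the origin are almost surely good
(`ae_eventually_zero_notMem_badBlocks`), which yields an infinite cluster
(`exists_infinite_class`).
-/

namespace SpatialNetwork

/-! ### Hierarchical percolation on the square lattice -/

/-- The `3 × 3` block containing a site; blocks are again indexed by `ℤ²`. -/
def parent (q : ℤ × ℤ) : ℤ × ℤ := (q.1 / 3, q.2 / 3)

/-- The bad blocks of side `3 ^ n`, for the set `B` of bad sites: a block is bad if at least two of
its nine sub-blocks are bad. -/
def badBlocks (B : Set (ℤ × ℤ)) : ℕ → Set (ℤ × ℤ)
  | 0 => B
  | n + 1 => {Q | ∃ q q', q ≠ q' ∧ parent q = Q ∧ parent q' = Q ∧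
      q ∈ badBlocks B n ∧ q' ∈ badBlocks B n}

/-- The core of a block of side `3 ^ n`: the sites that are reached by descending through good
sub-blocks only. -/
def blockCore (B : Set (ℤ × ℤ)) : ℕ → ℤ × ℤ → Set (ℤ × ℤ)
  | 0, Q => {Q}
  | n + 1, Q => {a | ∃ q, parent q = Q ∧ q ∉ badBlocks B n ∧ a ∈ blockCore B n q}

theorem eq_of_parent_eq_of_notMem_badBlocks {B : Set (ℤ × ℤ)} {n : ℕ} {Q q q' : ℤ × ℤ}
    (hQ : Q ∉ badBlocks B (n + 1)) (h : parent q = Q) (h' : parent q' = Q)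
    (hq : q ∈ badBlocks B n) (hq' : q' ∈ badBlocks B n) : q = q' := by
  by_contra hne
  exact hQ ⟨q, q', hne, h, h', hq, hq'⟩

theorem parent_child (Q : ℤ × ℤ) (i j : ℤ) (hi : 0 ≤ i ∧ i ≤ 2) (hj : 0 ≤ j ∧ j ≤ 2) :
    parent (3 * Q.1 + i, 3 * Q.2 + j) = Q := by
  ext <;> simp only [parent] <;> omega

/-- All but at most one of the sub-blocks of a good block are good. -/
theorem exists_child_forall_notMem_badBlocks {B : Set (ℤ × ℤ)} {n : ℕ} {Q : ℤ × ℤ}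
    (hQ : Q ∉ badBlocks B (n + 1)) :
    ∃ b : ℤ × ℤ, parent b = Q ∧ ∀ q, parent q = Q → q ≠ b → q ∉ badBlocks B n := by
  by_cases h : ∃ b, parent b = Q ∧ b ∈ badBlocks B n
  · obtain ⟨b, hb, hb'⟩ := h
    exact ⟨b, hb, fun q hq hne hq' =>
      hne (eq_of_parent_eq_of_notMem_badBlocks hQ hq hb hq' hb')⟩
  · refine ⟨(3 * Q.1 + 0, 3 * Q.2 + 0), parent_child Q 0 0 (by simp) (by simp),
      fun q hq _ hq' => ?_⟩
    exact h ⟨q, hq, hq'⟩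

theorem blockCore_nonempty {B : Set (ℤ × ℤ)} {n : ℕ} {Q : ℤ × ℤ} (hQ : Q ∉ badBlocks B n) :
    (blockCore B n Q).Nonempty := by
  induction n generalizing Q with
  | zero => exact ⟨Q, rfl⟩
  | succ n ih =>
    obtain ⟨b, hb, h⟩ := exists_child_forall_notMem_badBlocks hQ
    have : ∃ q, parent q = Q ∧ q ≠ b := by
      by_cases h0 : b = (3 * Q.1, 3 * Q.2)
      · refine ⟨(3 * Q.1 + 1, 3 * Q.2 + 0), parent_child Q 1 0 (by simp) (by simp), ?_⟩
        simp [h0]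
      · exact ⟨(3 * Q.1 + 0, 3 * Q.2 + 0), parent_child Q 0 0 (by simp) (by simp), by
          simpa using Ne.symm h0⟩
    obtain ⟨q, hq, hne⟩ := this
    obtain ⟨a, ha⟩ := ih (h q hq hne)
    exact ⟨a, q, hq, h q hq hne, ha⟩

theorem div_pow_of_mem_blockCore {B : Set (ℤ × ℤ)} {n : ℕ} {Q a : ℤ × ℤ}
    (ha : a ∈ blockCore B n Q) : a.1 / 3 ^ n = Q.1 ∧ a.2 / 3 ^ n = Q.2 := by
  induction n generalizing Q with
  | zero => obtain rfl : a = Q := ha; simp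
  | succ n ih =>
    obtain ⟨q, rfl, -, hq⟩ := ha
    obtain ⟨h1, h2⟩ := ih hq
    rw [pow_succ, ← Int.ediv_ediv_of_nonneg (by positivity),
      ← Int.ediv_ediv_of_nonneg (by positivity), h1, h2]
    exact ⟨rfl, rfl⟩

/-- In a `3 × 3` grid with at most one bad vertex `b`, the good vertices are connected: a row and
a column avoiding `b` form a good cross, to which every good vertex is joined along its row or its
column. -/
theorem grid_connected {good : ℤ × ℤ → Prop} {T : ℤ × ℤ → ℤ × ℤ → Prop}
    (hsymm : ∀ q q', T q q' → T q' q) (htrans : ∀ q q' q'', T q q' → T q' q'' → T q q'')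
    (hrefl : ∀ q, good q → T q q)
    (hright : ∀ x y, good (x, y) → good (x + 1, y) → T (x, y) (x + 1, y))
    (hup : ∀ x y, good (x, y) → good (x, y + 1) → T (x, y) (x, y + 1))
    {Q b : ℤ × ℤ} (hb : parent b = Q) (hgood : ∀ q, parent q = Q → q ≠ b → good q)
    {q q' : ℤ × ℤ} (hq : parent q = Q) (hq' : parent q' = Q) (hgq : good q) (hgq' : good q') :
    T q q' := by
  have hrow : ∀ y x x', (∀ i, parent (i, y) = Q → good (i, y)) → parent (x, y) = Q →
      parent (x', y) = Q → x ≤ x' → T (x, y) (x', y) := by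
    intro y x x' hg hx hx' hle
    obtain ⟨k, rfl⟩ := Int.le.dest hle
    induction k with
    | zero => simpa using hrefl _ (hg x hx)
    | succ k ih =>
      have hk : parent (x + k, y) = Q := by
        subst hx; simp only [parent, Prod.mk.injEq, and_true] at hx' ⊢; push_cast at hx'; omega
      have h1 := ih hk (by omega)
      have h2 := hright (x + k) y (hg _ hk) (by rw [add_assoc]; exact_mod_cast hg _ hx')
      refine htrans _ _ _ h1 ?_
      convert h2 using 2
      push_cast; ring
  have hcol : ∀ x y y', (∀ i, parent (x, i) = Q → good (x, i)) → parent (x, y) = Q →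
      parent (x, y') = Q → y ≤ y' → T (x, y) (x, y') := by
    intro x y y' hg hy hy' hle
    obtain ⟨k, rfl⟩ := Int.le.dest hle
    induction k with
    | zero => simpa using hrefl _ (hg y hy)
    | succ k ih =>
      have hk : parent (x, y + k) = Q := by
        subst hy; simp only [parent, Prod.mk.injEq, true_and] at hy' ⊢; push_cast at hy'; omega
      have h1 := ih hk (by omega)
      have h2 := hup x (y + k) (hg _ hk) (by rw [add_assoc]; exact_mod_cast hg _ hy')
      refine htrans _ _ _ h1 ?_
      convert h2 using 2
      push_cast; ring
  have hrow' : ∀ y x x', (∀ i, parent (i, y) = Q → good (i, y)) → parent (x, y) = Q →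
      parent (x', y) = Q → T (x, y) (x', y) := fun y x x' hg hx hx' =>
    (le_total x x').elim (hrow y x x' hg hx hx') fun h => hsymm _ _ (hrow y x' x hg hx' hx h)
  have hcol' : ∀ x y y', (∀ i, parent (x, i) = Q → good (x, i)) → parent (x, y) = Q →
      parent (x, y') = Q → T (x, y) (x, y') := fun x y y' hg hy hy' =>
    (le_total y y').elim (hcol x y y' hg hy hy') fun h => hsymm _ _ (hcol x y' y hg hy' hy h)
  obtain ⟨b1, b2⟩ := b
  have hb1 : b1 / 3 = Q.1 := congrArg Prod.fst hb
  have hb2 : b2 / 3 = Q.2 := congrArg Prod.snd hb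
  obtain ⟨x₀, hx₀, hx₀b⟩ : ∃ x₀, x₀ / 3 = Q.1 ∧ x₀ ≠ b1 := by
    by_cases h : b1 = 3 * Q.1
    · exact ⟨3 * Q.1 + 1, by omega, by omega⟩
    · exact ⟨3 * Q.1, by omega, Ne.symm h⟩
  obtain ⟨y₀, hy₀, hy₀b⟩ : ∃ y₀, y₀ / 3 = Q.2 ∧ y₀ ≠ b2 := by
    by_cases h : b2 = 3 * Q.2
    · exact ⟨3 * Q.2 + 1, by omega, by omega⟩
    · exact ⟨3 * Q.2, by omega, Ne.symm h⟩
  have hgrow : ∀ y, y ≠ b2 → ∀ i, parent (i, y) = Q → good (i, y) := fun y hy i hi =>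
    hgood _ hi fun h => hy (congrArg Prod.snd h)
  have hgcol : ∀ x, x ≠ b1 → ∀ i, parent (x, i) = Q → good (x, i) := fun x hx i hi =>
    hgood _ hi fun h => hx (congrArg Prod.fst h)
  have hpar : ∀ x y, x / 3 = Q.1 → y / 3 = Q.2 → parent (x, y) = Q := fun x y h h' =>
    Prod.ext h h'
  have key : ∀ q, parent q = Q → good q → T q (x₀, y₀) := by
    rintro ⟨x, y⟩ hq hg
    have hx : x / 3 = Q.1 := congrArg Prod.fst hq
    have hy : y / 3 = Q.2 := congrArg Prod.snd hq
    by_cases h : y = b2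
    · by_cases h' : x = b1
      · -- the vertex `b` itself is good: then its row is good
        subst h h'
        have hg' : ∀ i, parent (i, y) = Q → good (i, y) := fun i hi => by
          by_cases hix : i = x
          · exact hix ▸ hg
          · exact hgood _ hi fun h => hix (congrArg Prod.fst h)
        exact htrans _ _ _ (hrow' y x x₀ hg' hq (hpar _ _ hx₀ hy))
          (hcol' x₀ y y₀ (hgcol x₀ hx₀b) (hpar _ _ hx₀ hy) (hpar _ _ hx₀ hy₀))
      · exact htrans _ _ _ (hcol' x y y₀ (hgcol x h') hq (hpar _ _ hx hy₀))
          (hrow' y₀ x x₀ (hgrow y₀ hy₀b) (hpar _ _ hx hy₀) (hpar _ _ hx₀ hy₀))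
    · exact htrans _ _ _ (hrow' y x x₀ (hgrow y h) hq (hpar _ _ hx₀ hy))
        (hcol' x₀ y y₀ (hgcol x₀ hx₀b) (hpar _ _ hx₀ hy) (hpar _ _ hx₀ hy₀))
  exact htrans _ _ _ (key q hq hgq) (hsymm _ _ (key q' hq' hgq'))

/-- If neighbouring good sites are equivalent, then so are all sites in the cores of a good block
and of its good neighbours, at every scale. -/
theorem blockCore_related {B : Set (ℤ × ℤ)} {R : ℤ × ℤ → ℤ × ℤ → Prop} (hR : Equivalence R)
    (hright : ∀ x y, (x, y) ∉ B → (x + 1, y) ∉ B → R (x, y) (x + 1, y))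
    (hup : ∀ x y, (x, y) ∉ B → (x, y + 1) ∉ B → R (x, y) (x, y + 1)) (n : ℕ) :
    (∀ q, q ∉ badBlocks B n → ∀ a ∈ blockCore B n q, ∀ c ∈ blockCore B n q, R a c) ∧
    (∀ x y, (x, y) ∉ badBlocks B n → (x + 1, y) ∉ badBlocks B n →
      ∀ a ∈ blockCore B n (x, y), ∀ c ∈ blockCore B n (x + 1, y), R a c) ∧
    (∀ x y, (x, y) ∉ badBlocks B n → (x, y + 1) ∉ badBlocks B n →
      ∀ a ∈ blockCore B n (x, y), ∀ c ∈ blockCore B n (x, y + 1), R a c) := by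
  induction n with
  | zero =>
    refine ⟨?_, ?_, ?_⟩
    · rintro q - a rfl c rfl; exact hR.refl _
    · rintro x y h h' a rfl c rfl; exact hright x y h h'
    · rintro x y h h' a rfl c rfl; exact hup x y h h'
  | succ n ih =>
    obtain ⟨ih0, ih1, ih2⟩ := ih
    let T : ℤ × ℤ → ℤ × ℤ → Prop := fun q q' => q ∉ badBlocks B n ∧ q' ∉ badBlocks B n ∧
      ∀ a ∈ blockCore B n q, ∀ c ∈ blockCore B n q', R a c
    have hsymm : ∀ q q', T q q' → T q' q := fun q q' h =>
      ⟨h.2.1, h.1, fun a ha c hc => hR.symm (h.2.2 c hc a ha)⟩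
    have htrans : ∀ q q' q'', T q q' → T q' q'' → T q q'' := fun q q' q'' h h' =>
      ⟨h.1, h'.2.1, fun a ha c hc => by
        obtain ⟨d, hd⟩ := blockCore_nonempty h.2.1
        exact hR.trans (h.2.2 a ha d hd) (h'.2.2 d hd c hc)⟩
    have hconn : ∀ Q q q', Q ∉ badBlocks B (n + 1) → parent q = Q → parent q' = Q →
        q ∉ badBlocks B n → q' ∉ badBlocks B n → T q q' := by
      intro Q q q' hQ hq hq' hg hg'
      obtain ⟨b, hb, h⟩ := exists_child_forall_notMem_badBlocks hQ
      exact grid_connected (good := fun q => q ∉ badBlocks B n) hsymm htrans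
        (fun q h => ⟨h, h, ih0 q h⟩) (fun x y h h' => ⟨h, h', ih1 x y h h'⟩)
        (fun x y h h' => ⟨h, h', ih2 x y h h'⟩) hb h hq hq' hg hg'
    refine ⟨?_, ?_, ?_⟩
    · rintro Q hQ a ⟨q, hq, hg, ha⟩ c ⟨q', hq', hg', hc⟩
      exact (hconn Q q q' hQ hq hq' hg hg').2.2 a ha c hc
    · rintro X Y hQ hQ' a ⟨q, hq, hg, ha⟩ c ⟨q', hq', hg', hc⟩
      obtain ⟨⟨b1, b2⟩, -, hb⟩ := exists_child_forall_notMem_badBlocks hQ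
      obtain ⟨⟨d1, d2⟩, -, hd⟩ := exists_child_forall_notMem_badBlocks hQ'
      -- one of the three rows meets neither exceptional sub-block
      obtain ⟨j, hj, hjb, hjd⟩ : ∃ j, j / 3 = Y ∧ j ≠ b2 ∧ j ≠ d2 := by
        by_cases h0 : 3 * Y ≠ b2 ∧ 3 * Y ≠ d2
        · exact ⟨3 * Y, by omega, h0⟩
        by_cases h1 : 3 * Y + 1 ≠ b2 ∧ 3 * Y + 1 ≠ d2
        · exact ⟨3 * Y + 1, by omega, h1⟩
        · exact ⟨3 * Y + 2, by omega, by omega, by omega⟩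
      have hp : parent (3 * X + 2, j) = (X, Y) := Prod.ext (by simp only [parent]; omega) hj
      have hp' : parent (3 * X + 2 + 1, j) = (X + 1, Y) :=
        Prod.ext (by simp only [parent]; omega) hj
      have hgp := hb _ hp (fun h => hjb (congrArg Prod.snd h))
      have hgp' := hd _ hp' (fun h => hjd (congrArg Prod.snd h))
      exact (htrans _ _ _ (htrans _ _ _ (hconn _ q _ hQ hq hp hg hgp)
        ⟨hgp, hgp', ih1 _ _ hgp hgp'⟩) (hconn _ _ q' hQ' hp' hq' hgp' hg')).2.2 a ha c hc
    · rintro X Y hQ hQ' a ⟨q, hq, hg, ha⟩ c ⟨q', hq', hg', hc⟩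
      obtain ⟨⟨b1, b2⟩, -, hb⟩ := exists_child_forall_notMem_badBlocks hQ
      obtain ⟨⟨d1, d2⟩, -, hd⟩ := exists_child_forall_notMem_badBlocks hQ'
      obtain ⟨j, hj, hjb, hjd⟩ : ∃ j, j / 3 = X ∧ j ≠ b1 ∧ j ≠ d1 := by
        by_cases h0 : 3 * X ≠ b1 ∧ 3 * X ≠ d1
        · exact ⟨3 * X, by omega, h0⟩
        by_cases h1 : 3 * X + 1 ≠ b1 ∧ 3 * X + 1 ≠ d1
        · exact ⟨3 * X + 1, by omega, h1⟩
        · exact ⟨3 * X + 2, by omega, by omega, by omega⟩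
      have hp : parent (j, 3 * Y + 2) = (X, Y) := Prod.ext hj (by simp only [parent]; omega)
      have hp' : parent (j, 3 * Y + 2 + 1) = (X, Y + 1) :=
        Prod.ext hj (by simp only [parent]; omega)
      have hgp := hb _ hp (fun h => hjb (congrArg Prod.fst h))
      have hgp' := hd _ hp' (fun h => hjd (congrArg Prod.fst h))
      exact (htrans _ _ _ (htrans _ _ _ (hconn _ q _ hQ hq hp hg hgp)
        ⟨hgp, hgp', ih2 _ _ hgp hgp'⟩) (hconn _ _ q' hQ' hp' hq' hgp' hg')).2.2 a ha c hc

/-- If the blocks of index `0` are good at all large scales, then some equivalence class is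
infinite: these blocks are nested and share one class, and a good block of side `3 ^ (n + 1)` has a
good sub-block other than the one of index `0`, hence core sites at distance at least `3 ^ n` from
the origin. -/
theorem exists_infinite_class {B : Set (ℤ × ℤ)} {R : ℤ × ℤ → ℤ × ℤ → Prop} (hR : Equivalence R)
    (hright : ∀ x y, (x, y) ∉ B → (x + 1, y) ∉ B → R (x, y) (x + 1, y))
    (hup : ∀ x y, (x, y) ∉ B → (x, y + 1) ∉ B → R (x, y) (x, y + 1))
    (h0 : ∀ᶠ n in Filter.atTop, (0 : ℤ × ℤ) ∉ badBlocks B n) :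
    ∃ a, {c | R a c}.Infinite := by
  obtain ⟨n₀, hn₀⟩ := Filter.eventually_atTop.1 h0
  obtain ⟨a, ha⟩ := blockCore_nonempty (hn₀ n₀ le_rfl)
  have hmem : ∀ n, n₀ ≤ n → a ∈ blockCore B n 0 := by
    intro n hn
    induction n, hn using Nat.le_induction with
    | base => exact ha
    | succ n hn ih => exact ⟨0, rfl, hn₀ n hn, ih⟩
  refine ⟨a, fun hfin => ?_⟩
  have hfar : ∀ n, n₀ ≤ n → ∃ c, R a c ∧ (3 : ℤ) ^ n ≤ c.1 := by
    intro n hn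
    obtain ⟨⟨b1, b2⟩, -, hb⟩ := exists_child_forall_notMem_badBlocks (hn₀ (n + 1) (by omega))
    have hex : ∃ i : ℤ, 1 ≤ i ∧ i / 3 = 0 ∧ i ≠ b1 := by
      by_cases h : b1 = 1
      · exact ⟨2, by omega, by omega, by omega⟩
      · exact ⟨1, by omega, by omega, Ne.symm h⟩
    obtain ⟨i, hi1, hi3, hib⟩ := hex
    have hp : parent (i, 0) = 0 := Prod.ext hi3 (by simp [parent])
    have hg := hb _ hp (fun h => hib (congrArg Prod.fst h))
    obtain ⟨c, hc⟩ := blockCore_nonempty hg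
    refine ⟨c, (blockCore_related hR hright hup (n + 1)).1 0 (hn₀ _ (by omega)) a
      (hmem _ (by omega)) c ⟨_, hp, hg, hc⟩, ?_⟩
    have h1 : c.1 / 3 ^ n = i := (div_pow_of_mem_blockCore hc).1
    have h2 : 1 * 3 ^ n ≤ c.1 := (Int.le_ediv_iff_mul_le (by positivity)).1 (by omega)
    simpa using h2
  obtain ⟨K, hK⟩ := (hfin.image Prod.fst).bddAbove
  obtain ⟨c, hc, hc'⟩ := hfar (n₀ + K.toNat) (by omega)
  have h1 : c.1 ≤ K := hK ⟨c, hc, rfl⟩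
  have h2 : ((n₀ + K.toNat : ℕ) : ℤ) < 3 ^ (n₀ + K.toNat) := by
    exact_mod_cast Nat.lt_pow_self (by norm_num)
  push_cast at h2
  omega

/-- The nine sub-blocks of a block. -/
noncomputable def children (Q : ℤ × ℤ) : Finset (ℤ × ℤ) :=
  Finset.Icc (3 * Q.1) (3 * Q.1 + 2) ×ˢ Finset.Icc (3 * Q.2) (3 * Q.2 + 2)

theorem mem_children {Q q : ℤ × ℤ} : q ∈ children Q ↔ parent q = Q := by
  simp only [children, Finset.mem_product, Finset.mem_Icc, parent, Prod.ext_iff]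
  omega

theorem card_children (Q : ℤ × ℤ) : (children Q).card = 9 := by
  rw [children, Finset.card_product, Int.card_Icc, Int.card_Icc]
  have : ∀ x : ℤ, (x + 2 + 1 - x).toNat = 3 := fun x => by omega
  rw [this, this]

section Probability

variable {Ω κ : Type*}

theorem setOf_mem_badBlocks_succ (bad : ℤ × ℤ → Set Ω) (n : ℕ) (Q : ℤ × ℤ) :
    {ω | Q ∈ badBlocks {q | ω ∈ bad q} (n + 1)} =
      ⋃ p ∈ (children Q).offDiag, {ω | p.1 ∈ badBlocks {q | ω ∈ bad q} n} ∩
        {ω | p.2 ∈ badBlocks {q | ω ∈ bad q} n} := by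
  ext ω
  rw [Set.mem_iUnion₂]
  constructor
  · rintro ⟨q, q', hne, h, h', hq, hq'⟩
    exact ⟨(q, q'), Finset.mem_offDiag.2 ⟨mem_children.2 h, mem_children.2 h', hne⟩, hq, hq'⟩
  · rintro ⟨⟨q, q'⟩, h, hq, hq'⟩
    obtain ⟨h1, h2, hne⟩ := Finset.mem_offDiag.1 h
    exact ⟨q, q', hne, mem_children.1 h1, mem_children.1 h2, hq, hq'⟩

/-- The event that a block is bad depends on the σ-algebras owned by the sites of the block. -/
theorem measurableSet_mem_badBlocks {m : κ → MeasurableSpace Ω} {owner : κ → ℤ × ℤ}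
    {bad : ℤ × ℤ → Set Ω}
    (hbad : ∀ q, MeasurableSet[⨆ k ∈ owner ⁻¹' {q}, m k] (bad q)) (n : ℕ) (Q : ℤ × ℤ) :
    MeasurableSet[⨆ k ∈ (fun k => parent^[n] (owner k)) ⁻¹' {Q}, m k]
      {ω | Q ∈ badBlocks {q | ω ∈ bad q} n} := by
  induction n generalizing Q with
  | zero => exact hbad Q
  | succ n ih =>
    rw [setOf_mem_badBlocks_succ]
    have hle : ∀ q ∈ children Q, MeasurableSet[⨆ k ∈ (fun k => parent^[n + 1] (owner k)) ⁻¹' {Q},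
        m k] {ω | q ∈ badBlocks {q | ω ∈ bad q} n} := by
      intro q hq
      refine (biSup_mono ?_ : (⨆ k ∈ (fun k => parent^[n] (owner k)) ⁻¹' {q}, m k) ≤ _) _ (ih q)
      intro k hk
      rw [mem_children] at hq
      simp only [Set.mem_preimage, Set.mem_singleton_iff] at hk ⊢
      rw [Function.iterate_succ_apply', hk, hq]
    refine Finset.measurableSet_biUnion _ fun p hp => ?_
    rw [Finset.mem_offDiag] at hp
    exact (hle _ hp.1).inter (hle _ hp.2.1)

variable [mΩ : MeasurableSpace Ω]

/-- Disjoint blocks are independent, so that the probability `p n` of a block of side `3 ^ n` being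
bad satisfies `p (n + 1) ≤ 72 * p n ^ 2`. Starting from `p 0 ≤ 1 / 144` it decays geometrically. -/
theorem measure_mem_badBlocks_le {P : Measure Ω} {m : κ → MeasurableSpace Ω} (hm : ∀ k, m k ≤ mΩ)
    (hind : iIndep m P) {owner : κ → ℤ × ℤ} {bad : ℤ × ℤ → Set Ω}
    (hbad : ∀ q, MeasurableSet[⨆ k ∈ owner ⁻¹' {q}, m k] (bad q))
    (hp : ∀ q, P (bad q) ≤ 144⁻¹) (n : ℕ) (Q : ℤ × ℤ) :
    P {ω | Q ∈ badBlocks {q | ω ∈ bad q} n} ≤ 144⁻¹ * (2⁻¹) ^ n := by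
  induction n generalizing Q with
  | zero => rw [pow_zero, mul_one]; exact hp Q
  | succ n ih =>
    rw [setOf_mem_badBlocks_succ]
    calc P _ ≤ ∑ p ∈ (children Q).offDiag, P ({ω | p.1 ∈ badBlocks {q | ω ∈ bad q} n} ∩
          {ω | p.2 ∈ badBlocks {q | ω ∈ bad q} n}) := measure_biUnion_finset_le _ _
      _ ≤ ∑ p ∈ (children Q).offDiag, (144⁻¹ * (2⁻¹) ^ n) * (144⁻¹ * (2⁻¹) ^ n) := by
        refine Finset.sum_le_sum fun p hp => ?_
        have hne := (Finset.mem_offDiag.1 hp).2.2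
        have hI := indep_iSup_of_disjoint hm hind
          (S := (fun k => parent^[n] (owner k)) ⁻¹' {p.1})
          (T := (fun k => parent^[n] (owner k)) ⁻¹' {p.2})
          (Disjoint.preimage _ (by simpa using hne))
        rw [Indep_iff _ _ _ |>.1 hI _ _ (measurableSet_mem_badBlocks hbad n p.1)
          (measurableSet_mem_badBlocks hbad n p.2)]
        gcongr
        · exact ih _
        · exact ih _
      _ = 72 * ((144⁻¹ * (2⁻¹) ^ n) * (144⁻¹ * (2⁻¹) ^ n)) := by
        rw [Finset.sum_const, Finset.offDiag_card, card_children]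
        simp
      _ = (72 * 144⁻¹) * (144⁻¹ * (2⁻¹) ^ n) * (2⁻¹) ^ n := by ring
      _ ≤ 2⁻¹ * (144⁻¹ * (2⁻¹) ^ n) * 1 := by
        gcongr
        · rw [← div_eq_mul_inv]
          refine ENNReal.div_le_of_le_mul ?_
          rw [show (144 : ℝ≥0∞) = 2 * 72 by norm_num, ← mul_assoc,
            ENNReal.inv_mul_cancel (by simp) (by simp), one_mul]
        · exact pow_le_one₀ (by simp) (by simp)
      _ = 144⁻¹ * (2⁻¹) ^ (n + 1) := by ring

theorem ae_eventually_zero_notMem_badBlocks {P : Measure Ω} {m : κ → MeasurableSpace Ω}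
    (hm : ∀ k, m k ≤ mΩ) (hind : iIndep m P) {owner : κ → ℤ × ℤ} {bad : ℤ × ℤ → Set Ω}
    (hbad : ∀ q, MeasurableSet[⨆ k ∈ owner ⁻¹' {q}, m k] (bad q))
    (hp : ∀ q, P (bad q) ≤ 144⁻¹) :
    ∀ᵐ ω ∂P, ∀ᶠ n in Filter.atTop, (0 : ℤ × ℤ) ∉ badBlocks {q | ω ∈ bad q} n := by
  refine ae_eventually_notMem (s := fun n => {ω | (0 : ℤ × ℤ) ∈ badBlocks {q | ω ∈ bad q} n}) ?_
  refine ne_top_of_le_ne_top ?_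
    (ENNReal.tsum_le_tsum fun n => measure_mem_badBlocks_le hm hind hbad hp n 0)
  rw [ENNReal.tsum_mul_left, ENNReal.tsum_geometric]
  refine ENNReal.mul_ne_top (by simp) ?_
  simp

end Probability

/-! ### Path loss summed over a regular family of points -/

/-- A family of points of the plane that is uniformly locally finite (every open disk of radius `1`
contains at most `N` of them) and relatively dense (every point of the plane is within distance `R`
of one of them). -/
structure IsRegular {ι : Type*} (pos : ι → Plane) (N : ℕ) (R : ℝ) : Prop where
  encard_le : ∀ c, {z | pos z ∈ Metric.ball c 1}.encard ≤ N
  exists_near : ∀ c, ∃ z, dist (pos z) c ≤ R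

/-- The sum over the cells `c` of `ℤ²` of the path loss at a lower bound for the distance from the
origin to the unit square with lower left corner `c`. The subtraction is truncated. -/
noncomputable def latticePathLoss (ℓ : ℝ → ℝ) : ℝ≥0∞ :=
  ∑' c : ℤ × ℤ, ENNReal.ofReal (ℓ ((max c.1.natAbs c.2.natAbs - 1 : ℕ) : ℝ))

theorem tsum_mul_pathLoss_lt_top {ℓ : ℝ → ℝ} (hℓ : IsPathLoss ℓ) :
    ∑' k : ℕ, ENNReal.ofReal (k * ℓ (k + 1)) < ∞ := by
  have hdisj : Pairwise (Function.onFun Disjoint fun k : ℕ => Set.Ioc (k : ℝ) (k + 1)) := by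
    intro i j hij
    refine Set.disjoint_left.2 fun x hx hx' => hij ?_
    have h1 : (i : ℝ) < j + 1 := hx.1.trans_le hx'.2
    have h2 : (j : ℝ) < i + 1 := hx'.1.trans_le hx.2
    have h1' : i < j + 1 := by exact_mod_cast h1
    have h2' : j < i + 1 := by exact_mod_cast h2
    omega
  calc ∑' k : ℕ, ENNReal.ofReal (k * ℓ (k + 1))
      ≤ ∑' k : ℕ, ∫⁻ r in Set.Ioc (k : ℝ) (k + 1), ENNReal.ofReal (r * ℓ r) := by
        refine ENNReal.tsum_le_tsum fun k => ?_
        have h := setLIntegral_mono' (μ := volume) (s := Set.Ioc (k : ℝ) (k + 1))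
          (f := fun _ => ENNReal.ofReal (k * ℓ (k + 1))) (g := fun r => ENNReal.ofReal (r * ℓ r))
          measurableSet_Ioc fun r hr => by
            have h0 : (0 : ℝ) ≤ r := (Nat.cast_nonneg k).trans hr.1.le
            refine ENNReal.ofReal_le_ofReal (mul_le_mul hr.1.le
              (hℓ.antitone h0 (by simp; positivity) hr.2) (hℓ.pos _ (by positivity)).le h0)
        rwa [setLIntegral_const, Real.volume_Ioc, add_sub_cancel_left, ENNReal.ofReal_one,
          mul_one] at h
    _ = ∫⁻ r in ⋃ k : ℕ, Set.Ioc (k : ℝ) (k + 1), ENNReal.ofReal (r * ℓ r) :=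
        (lintegral_iUnion (fun _ => measurableSet_Ioc) hdisj _).symm
    _ ≤ ∫⁻ r in Set.Ioi 0, ENNReal.ofReal (r * ℓ r) :=
        lintegral_mono_set (Set.iUnion_subset fun k r hr => (Nat.cast_nonneg k).trans_lt hr.1)
    _ < ∞ := hℓ.integrable.lintegral_lt_top

theorem latticePathLoss_lt_top {ℓ : ℝ → ℝ} (hℓ : IsPathLoss ℓ) : latticePathLoss ℓ < ∞ := by
  let g : ℕ → ℝ≥0∞ := fun n => ENNReal.ofReal (ℓ ((n - 1 : ℕ) : ℝ))
  -- the number of `c` with sup norm `n` is `8 * n` for `n ≠ 0`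
  have h1 : latticePathLoss ℓ ≤ ∑' n : ℕ, (8 * n + 1 : ℕ) * g n := by
    rw [latticePathLoss, ← ENNReal.tsum_fiberwise _ fun c : ℤ × ℤ => max c.1.natAbs c.2.natAbs]
    refine ENNReal.tsum_le_tsum fun n => ?_
    have hset : (fun c : ℤ × ℤ => max c.1.natAbs c.2.natAbs) ⁻¹' {n}
        = ((Finset.box n : Finset (ℤ × ℤ)) : Set (ℤ × ℤ)) := by
      ext c; simp [Int.mem_box]
    calc _ = ∑' _ : ((fun c : ℤ × ℤ => max c.1.natAbs c.2.natAbs) ⁻¹' {n} : Set (ℤ × ℤ)), g n :=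
          tsum_congr fun b => by
            have hb : max b.1.1.natAbs b.1.2.natAbs = n := b.2
            simp only [g, hb]
      _ = _ := ENNReal.tsum_set_const _ _
      _ ≤ _ := by
        rw [hset, Set.encard_coe_eq_coe_finsetCard]
        gcongr
        rcases eq_or_ne n 0 with rfl | hn
        · simp
        · rw [Int.card_box hn]
          simp only [ENat.toENNReal_coe, Nat.cast_le]
          omega
  refine h1.trans_lt ?_
  rw [← ENNReal.summable.sum_add_tsum_nat_add' (k := 3)]
  refine ENNReal.add_lt_top.2 ⟨?_, ?_⟩
  · refine ENNReal.sum_lt_top.2 fun n _ => ?_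
    exact ENNReal.mul_lt_top (ENNReal.natCast_lt_top _) ENNReal.ofReal_lt_top
  · have h2 : ∀ k : ℕ, ((8 * (k + 3) + 1 : ℕ) : ℝ≥0∞) * g (k + 3)
        ≤ 25 * ENNReal.ofReal ((k + 1 : ℕ) * ℓ ((k + 1 : ℕ) + 1)) := by
      intro k
      have h3 : ((k + 3 - 1 : ℕ) : ℝ) = ((k + 1 : ℕ) : ℝ) + 1 := by
        rw [show k + 3 - 1 = k + 1 + 1 by omega]; push_cast; ring
      simp only [g]
      rw [h3, ENNReal.ofReal_mul (by positivity), ENNReal.ofReal_natCast, ← mul_assoc]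
      gcongr
      norm_cast
      omega
    refine (ENNReal.tsum_le_tsum h2).trans_lt ?_
    rw [ENNReal.tsum_mul_left]
    refine ENNReal.mul_lt_top (by simp) (lt_of_le_of_lt ?_ (tsum_mul_pathLoss_lt_top hℓ))
    exact ENNReal.tsum_comp_le_tsum_of_injective (f := fun k : ℕ => k + 1)
      (add_left_injective 1) fun k : ℕ => ENNReal.ofReal (k * ℓ (k + 1))

theorem abs_sub_apply_le_dist (x y : Plane) (i : Fin 2) : |x i - y i| ≤ dist x y := by
  rw [dist_eq_norm]
  simpa using PiLp.norm_apply_le (x - y) i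

theorem dist_le_abs_add_abs (x y : Plane) : dist x y ≤ |x 0 - y 0| + |x 1 - y 1| := by
  rw [EuclideanSpace.dist_eq, Fin.sum_univ_two, Real.dist_eq, Real.dist_eq]
  refine Real.sqrt_le_iff.2 ⟨by positivity, ?_⟩
  nlinarith [abs_nonneg (x 0 - y 0), abs_nonneg (x 1 - y 1)]

/-- In a uniformly locally finite family, the total path loss seen from any point is bounded: each
of the unit squares of the lattice translated to that point contains at most `N` points. -/
theorem IsRegular.tsum_pathLoss_le {ι : Type*} {pos : ι → Plane} {N : ℕ} {R : ℝ}
    (hpos : IsRegular pos N R) {ℓ : ℝ → ℝ} (hℓ : IsPathLoss ℓ) (y : Plane) :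
    ∑' z, ENNReal.ofReal (ℓ (dist (pos z) y)) ≤ N * latticePathLoss ℓ := by
  let cell : ι → ℤ × ℤ := fun z => (⌊pos z 0 - y 0⌋, ⌊pos z 1 - y 1⌋)
  rw [← ENNReal.tsum_fiberwise _ cell, latticePathLoss, ← ENNReal.tsum_mul_left]
  refine ENNReal.tsum_le_tsum fun c => ?_
  have hfl : ∀ z, cell z = c → ((c.1 : ℝ) ≤ pos z 0 - y 0 ∧ pos z 0 - y 0 < c.1 + 1) ∧
      ((c.2 : ℝ) ≤ pos z 1 - y 1 ∧ pos z 1 - y 1 < c.2 + 1) := by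
    rintro z rfl
    exact ⟨⟨Int.floor_le _, Int.lt_floor_add_one _⟩, Int.floor_le _, Int.lt_floor_add_one _⟩
  calc _ ≤ ∑' _ : (cell ⁻¹' {c} : Set ι),
        ENNReal.ofReal (ℓ ((max c.1.natAbs c.2.natAbs - 1 : ℕ) : ℝ)) := by
        refine ENNReal.tsum_le_tsum fun z => ENNReal.ofReal_le_ofReal ?_
        refine hℓ.antitone (by simp) dist_nonneg ?_
        obtain ⟨⟨h1, h2⟩, h3, h4⟩ := hfl z z.2
        have key : ∀ (t d : ℝ) (a : ℤ), (a : ℝ) ≤ t → t < a + 1 → |t| ≤ d →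
            (a.natAbs : ℝ) ≤ d + 1 := by
          intro t d a ha ha' hd
          rw [Nat.cast_natAbs, Int.cast_abs]
          have := abs_le.1 hd
          refine abs_le.2 ⟨by linarith, by linarith⟩
        have k1 := key _ _ _ h1 h2 (abs_sub_apply_le_dist (pos z) y 0)
        have k2 := key _ _ _ h3 h4 (abs_sub_apply_le_dist (pos z) y 1)
        have k3 : ((max c.1.natAbs c.2.natAbs : ℕ) : ℝ) ≤ dist (pos z) y + 1 := by
          push_cast; exact max_le k1 k2
        rcases Nat.eq_zero_or_pos (max c.1.natAbs c.2.natAbs) with h0 | h0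
        · rw [h0]; simp
        · rw [Nat.cast_sub h0]; push_cast; push_cast at k3; linarith
    _ = _ := ENNReal.tsum_set_const _ _
    _ ≤ _ := by
        gcongr
        have hsub : cell ⁻¹' {c} ⊆
            {z | pos z ∈ Metric.ball (!₂[y 0 + c.1 + 1 / 2, y 1 + c.2 + 1 / 2] : Plane) 1} := by
          intro z hz
          obtain ⟨⟨h1, h2⟩, h3, h4⟩ := hfl z hz
          simp only [Set.mem_ofPred_eq, Metric.mem_ball]
          rw [EuclideanSpace.dist_eq, Fin.sum_univ_two, Real.dist_eq, Real.dist_eq, sq_abs, sq_abs]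
          rw [Real.sqrt_lt' one_pos]
          simp only [Matrix.cons_val_zero, Matrix.cons_val_one]
          nlinarith
        exact_mod_cast (Set.encard_le_encard hsub).trans (hpos.encard_le _)

/-! ### Points near a square lattice -/

/-- The centre of the square of index `q` in the tiling of the plane by squares of side `2 * s`. -/
noncomputable def gridPoint (s : ℝ) (q : ℤ × ℤ) : Plane := !₂[2 * q.1 * s, 2 * q.2 * s]

theorem dist_gridPoint_le {s : ℝ} (hs : 0 ≤ s) (q q' : ℤ × ℤ) :
    dist (gridPoint s q) (gridPoint s q')
      ≤ 2 * s * (|(q.1 - q'.1 : ℝ)| + |(q.2 - q'.2 : ℝ)|) := by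
  refine (dist_le_abs_add_abs _ _).trans (le_of_eq ?_)
  have h : ∀ a b : ℝ, |2 * a * s - 2 * b * s| = 2 * s * |a - b| := fun a b => by
    rw [show 2 * a * s - 2 * b * s = 2 * s * (a - b) by ring, abs_mul,
      abs_of_nonneg (by positivity)]
  simp only [gridPoint, Matrix.cons_val_zero, Matrix.cons_val_one, h]
  ring

theorem le_dist_gridPoint {s : ℝ} (hs : 0 ≤ s) {q q' : ℤ × ℤ} (h : q ≠ q') :
    2 * s ≤ dist (gridPoint s q) (gridPoint s q') := by
  have key : ∀ a b : ℤ, a ≠ b → 2 * s ≤ |2 * (a : ℝ) * s - 2 * b * s| := fun a b hab => by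
    rw [show 2 * (a : ℝ) * s - 2 * b * s = 2 * s * (a - b) by ring, abs_mul,
      abs_of_nonneg (by positivity : 0 ≤ 2 * s)]
    have : (1 : ℝ) ≤ |(a - b : ℝ)| := by
      exact_mod_cast Int.one_le_abs (sub_ne_zero.2 hab)
    nlinarith
  by_cases h1 : q.1 = q'.1
  · have h2 : q.2 ≠ q'.2 := fun h2 => h (Prod.ext h1 h2)
    refine (key _ _ h2).trans (le_trans (le_of_eq ?_) (abs_sub_apply_le_dist _ _ 1))
    simp [gridPoint]
  · refine (key _ _ h1).trans (le_trans (le_of_eq ?_) (abs_sub_apply_le_dist _ _ 0))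
    simp [gridPoint]

theorem injective_of_dist_gridPoint_le {ι : Type*} {pos : ι → Plane} {R : ℝ} (hR : 0 < R)
    {v : ℤ × ℤ → ι} (hv : ∀ q, dist (pos (v q)) (gridPoint (2 * R) q) ≤ R) :
    Function.Injective v := by
  intro q q' h
  by_contra hne
  have h1 := le_dist_gridPoint (s := 2 * R) (by positivity) hne
  have h2 := dist_triangle_left (gridPoint (2 * R) q) (gridPoint (2 * R) q') (pos (v q))
  have h3 := hv q
  have h4 := hv q'
  rw [← h] at h4
  linarith

theorem dist_le_of_dist_gridPoint_le {R : ℝ} (hR : 0 ≤ R) {x y : Plane} {q q' : ℤ × ℤ}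
    (hx : dist x (gridPoint (2 * R) q) ≤ R) (hy : dist y (gridPoint (2 * R) q') ≤ R) {d : ℝ}
    (hd : |(q.1 - q'.1 : ℝ)| + |(q.2 - q'.2 : ℝ)| ≤ d) :
    dist x y ≤ 2 * R + 4 * R * d := by
  have h1 := dist_triangle4 x (gridPoint (2 * R) q) (gridPoint (2 * R) q') y
  have h2 := dist_gridPoint_le (s := 2 * R) (by positivity) q q'
  rw [dist_comm y] at hy
  nlinarith

/-! ### Links of the SINR graph -/

section Links

variable {ι : Type*} {ℓ : ℝ → ℝ} {W : ℝ≥0} {pos : ι → Plane} {g : ι → ι → ℝ≥0}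

theorem interference_le_tsum (x y : ι) :
    interference ℓ pos g x y ≤ ∑' z, power ℓ pos g z y :=
  ENNReal.tsum_comp_le_tsum_of_injective Subtype.val_injective _

theorem lt_sinr (hℓ : IsPathLoss ℓ) {x y : ι} {ε K : ℝ≥0} {D θ : ℝ}
    (hD : dist (pos x) (pos y) ≤ D) (hε : ε ≤ g x y) (hK : ∑' z, power ℓ pos g z y ≤ K)
    (hθ : ENNReal.ofReal θ * (K + W) < ε * ENNReal.ofReal (ℓ D)) :
    ENNReal.ofReal θ < sinr ℓ W pos g x y := by
  have hI : interference ℓ pos g x y ≤ K := (interference_le_tsum x y).trans hK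
  have hI' : interference ℓ pos g x y + W ≤ K + W := by gcongr
  rw [sinr, ENNReal.lt_div_iff_mul_lt (Or.inr ENNReal.ofReal_ne_top)
    (Or.inl (ne_top_of_le_ne_top (by finiteness) hI'))]
  calc _ ≤ ENNReal.ofReal θ * (K + W) := by gcongr
    _ < ε * ENNReal.ofReal (ℓ D) := hθ
    _ ≤ power ℓ pos g x y := by
      rw [power]
      gcongr
      exact hℓ.antitone dist_nonneg (dist_nonneg.trans hD) hD

theorem sinrGraph_adj (hℓ : IsPathLoss ℓ) {x y : ι} (hxy : x ≠ y) {ε K : ℝ≥0} {D θ : ℝ}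
    (hD : dist (pos x) (pos y) ≤ D) (hε : ε ≤ g x y) (hε' : ε ≤ g y x)
    (hK : ∑' z, power ℓ pos g z y ≤ K) (hK' : ∑' z, power ℓ pos g z x ≤ K)
    (hθ : ENNReal.ofReal θ * (K + W) < ε * ENNReal.ofReal (ℓ D)) :
    (sinrGraph ℓ W pos g θ).Adj x y :=
  ⟨hxy, lt_sinr hℓ hD hε hK hθ, lt_sinr hℓ (by rwa [dist_comm]) hε' hK' hθ⟩

theorem exists_threshold (hℓ : IsPathLoss ℓ) {ε : ℝ≥0} (hε : 0 < ε) (K W : ℝ≥0) {D : ℝ}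
    (hD : 0 ≤ D) :
    ∃ θ₀ : ℝ, 0 < θ₀ ∧ ∀ θ : ℝ, 0 < θ → θ < θ₀ →
      ENNReal.ofReal θ * (K + W) < ε * ENNReal.ofReal (ℓ D) := by
  have hℓD := hℓ.pos D hD
  have hKW : (0 : ℝ) < K + W + 1 := by positivity
  refine ⟨ε * ℓ D / (K + W + 1), by positivity, fun θ h0 hθ => ?_⟩
  rw [lt_div_iff₀ hKW] at hθ
  have h1 : ((K : ℝ≥0∞) + W) = ENNReal.ofReal (K + W) := by
    rw [ENNReal.ofReal_add (by positivity) (by positivity)]; simp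
  rw [h1, ← ENNReal.ofReal_coe_nnreal (p := ε), ← ENNReal.ofReal_mul h0.le,
    ← ENNReal.ofReal_mul (by positivity)]
  refine (ENNReal.ofReal_lt_ofReal_iff (by positivity)).2 ?_
  nlinarith

end Links

/-! ### Regularity of stationary regulated point processes -/

theorem IsRegular.of_bijective {ι ι' : Type*} {pos : ι → Plane} {pos' : ι' → Plane} {N : ℕ} {R : ℝ}
    (h : IsRegular pos N R) {f : ι' → ι} (hf : Function.Bijective f) {t : Plane}
    (hpos : ∀ z, pos' z = pos (f z) + t) : IsRegular pos' N R where
  encard_le c := by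
    refine le_trans ?_ (h.encard_le (c - t))
    rw [← hf.1.encard_image]
    refine Set.encard_le_encard ?_
    rintro _ ⟨z, hz, rfl⟩
    simp only [Set.mem_ofPred_eq, Metric.mem_ball, hpos, dist_eq_norm] at hz ⊢
    rwa [show pos (f z) - (c - t) = pos (f z) + t - c by abel]
  exists_near c := by
    obtain ⟨z, hz⟩ := h.exists_near (c - t)
    obtain ⟨z, rfl⟩ := hf.2 z
    refine ⟨z, ?_⟩
    rw [hpos, dist_eq_norm]
    rwa [dist_eq_norm, show pos (f z) - (c - t) = pos (f z) + t - c by abel] at hz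

theorem Config.toMeasure_apply (φ : Config) {B : Set Plane} (hB : MeasurableSet B) :
    φ.toMeasure B = (φ.points ∩ B).encard := by
  rw [Config.toMeasure, Measure.restrict_apply hB,
    Measure.count_apply (hB.inter φ.countable_points.measurableSet), Set.inter_comm]

theorem Config.toMeasure_apply_eq_card (φ : Config) {B : Set Plane} (hB : MeasurableSet B)
    (hb : Bornology.IsBounded B) : φ.toMeasure B = φ.card B := by
  rw [φ.toMeasure_apply hB, Config.card, ← (φ.locallyFinite B hb).cast_ncard_eq]
  simp

theorem measurable_toMeasure_apply {B : Set Plane} (hB : MeasurableSet B) :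
    Measurable fun φ : Config => φ.toMeasure B :=
  Kernel.measurable_coe pointKernel hB

theorem one_le_toMeasure_iff (φ : Config) {B : Set Plane} (hB : MeasurableSet B) :
    1 ≤ φ.toMeasure B ↔ ∃ x ∈ φ.points, x ∈ B := by
  rw [φ.toMeasure_apply hB, ← ENat.toENNReal_one, ENat.toENNReal_le, Set.one_le_encard_iff_nonempty]
  rfl

/-- A measurable set of configurations, defined through disks with centres in a countable dense set,
that have at most `N` points in open unit disks and a point in closed disks of radius `t`. -/
def regularConfigs (N : ℕ) (t : ℝ) : Set Config :=
  {φ | ∀ n, φ.toMeasure (Metric.ball (TopologicalSpace.denseSeq Plane n) 1) ≤ N ∧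
    1 ≤ φ.toMeasure (Metric.closedBall (TopologicalSpace.denseSeq Plane n) t)}

theorem measurableSet_regularConfigs (N : ℕ) (t : ℝ) : MeasurableSet (regularConfigs N t) := by
  have : regularConfigs N t = ⋂ n,
      {φ | φ.toMeasure (Metric.ball (TopologicalSpace.denseSeq Plane n) 1) ≤ (N : ℝ≥0∞)} ∩
      {φ | 1 ≤ φ.toMeasure (Metric.closedBall (TopologicalSpace.denseSeq Plane n) t)} := by
    ext φ; rw [Set.mem_iInter]; rfl
  rw [this]
  exact MeasurableSet.iInter fun n =>
    (measurableSet_le (measurable_toMeasure_apply measurableSet_ball) measurable_const).inter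
      (measurableSet_le measurable_const (measurable_toMeasure_apply measurableSet_closedBall))

theorem isRegular_of_mem_regularConfigs {φ : Config} {N : ℕ} {t : ℝ}
    (h : φ ∈ regularConfigs N t) : IsRegular (fun x : φ.points => (x : Plane)) N (t + 1) where
  encard_le c := by
    have hfin : (φ.points ∩ Metric.ball c 1).Finite := φ.locallyFinite _ Metric.isBounded_ball
    -- a small displacement of the disk does not lose any of its finitely many points
    have hopen : IsOpen (⋂ x ∈ φ.points ∩ Metric.ball c 1, Metric.ball x 1) :=
      hfin.isOpen_biInter fun x _ => Metric.isOpen_ball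
    obtain ⟨n, hd⟩ := (TopologicalSpace.denseRange_denseSeq Plane).exists_mem_open hopen
      ⟨c, by simp only [Set.mem_iInter]; exact fun x hx => Metric.mem_ball_comm.1 hx.2⟩
    have h1 := (h n).1
    rw [φ.toMeasure_apply measurableSet_ball, ← ENat.toENNReal_coe, ENat.toENNReal_le] at h1
    refine le_trans ?_ h1
    rw [← Subtype.val_injective.encard_image]
    refine Set.encard_le_encard ?_
    rintro _ ⟨x, hx, rfl⟩
    exact ⟨x.2, Metric.mem_ball_comm.1 (Set.mem_iInter₂.1 hd x ⟨x.2, hx⟩)⟩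
  exists_near c := by
    obtain ⟨n, hn⟩ := (TopologicalSpace.denseRange_denseSeq Plane).exists_dist_lt c one_pos
    obtain ⟨x, hx, hx'⟩ := (one_le_toMeasure_iff φ measurableSet_closedBall).1 (h n).2
    refine ⟨⟨x, hx⟩, (dist_triangle_right _ _ (TopologicalSpace.denseSeq Plane n)).trans ?_⟩
    exact add_le_add hx' hn.le

theorem IsRegular.mem_regularConfigs {φ : Config} {N : ℕ} {R : ℝ}
    (h : IsRegular (fun x : φ.points => (x : Plane)) N R) : φ ∈ regularConfigs N R := by
  refine fun n => ⟨?_, ?_⟩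
  · rw [φ.toMeasure_apply measurableSet_ball, ← ENat.toENNReal_coe, ENat.toENNReal_le]
    refine le_trans ?_ (h.encard_le (TopologicalSpace.denseSeq Plane n))
    rw [← Subtype.val_injective.encard_image]
    exact Set.encard_le_encard fun x hx => ⟨⟨x, hx.1⟩, hx.2, rfl⟩
  · obtain ⟨x, hx⟩ := h.exists_near (TopologicalSpace.denseSeq Plane n)
    exact (one_le_toMeasure_iff φ measurableSet_closedBall).2 ⟨x, x.2, hx⟩

theorem IsRegular.translate {φ : Config} {N : ℕ} {R : ℝ}
    (h : IsRegular (fun x : φ.points => (x : Plane)) N R) (t : Plane) :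
    IsRegular (fun x : (φ.translate t).points => (x : Plane)) N R := by
  have hmem : ∀ x : (φ.translate t).points, (x : Plane) - t ∈ φ.points := by
    rintro ⟨_, x, hx, rfl⟩
    simpa using hx
  refine h.of_bijective (f := fun x => ⟨x - t, hmem x⟩) (t := t) ⟨fun x y hxy => ?_, fun x => ?_⟩
    (fun z => by simp)
  · exact Subtype.ext (sub_left_injective (congrArg Subtype.val hxy))
  · exact ⟨⟨x + t, x, x.2, rfl⟩, Subtype.ext (by simp)⟩

theorem Config.toMeasure_translate_neg_apply (φ : Config) (t : Plane) {B : Set Plane}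
    (hB : MeasurableSet B) :
    (φ.translate (-t)).toMeasure B = φ.toMeasure ((fun x => x - t) ⁻¹' B) := by
  rw [Config.toMeasure_translate, Measure.map_apply (by fun_prop) hB]
  simp only [sub_eq_add_neg]

/-- By stationarity the regulation properties, which concern disks around the origin, hold
simultaneously for disks around all points of a countable dense set. -/
theorem ae_mem_regularConfigs {Ω : Type*} [MeasurableSpace Ω] {P : Measure Ω} {Φ : Ω → Config}
    (hΦ : IsPointProcess Φ) (hstat : IsStationary P Φ) {σ ρ ν τ : ℝ}
    (hball : StronglyBallRegulated P Φ σ ρ ν) (hvoid : StronglyVoidRegulated P Φ τ) :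
    ∀ᵐ ω ∂P, Φ ω ∈ regularConfigs ⌊σ + ρ + ν⌋₊ τ := by
  have hΦ' : Measurable Φ := hΦ
  refine ae_all_iff.2 fun n => ?_
  set q := TopologicalSpace.denseSeq Plane n
  have htr : Measurable fun ω => (Φ ω).translate (-q) :=
    measurable_shift.comp (hΦ'.prodMk measurable_const)
  have htransfer : ∀ S : Set Config, MeasurableSet S → (∀ᵐ ω ∂P, Φ ω ∈ S) →
      ∀ᵐ ω ∂P, (Φ ω).translate (-q) ∈ S := by
    intro S hS h
    have h1 : ∀ᵐ φ ∂(P.map Φ), φ ∈ S := (ae_map_iff hΦ'.aemeasurable hS).2 h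
    rw [← hstat (-q)] at h1
    exact (ae_map_iff htr.aemeasurable hS).1 h1
  have h1 := htransfer {φ | φ.toMeasure (Metric.ball 0 1) ≤ (⌊σ + ρ + ν⌋₊ : ℕ)}
    (measurableSet_le (measurable_toMeasure_apply measurableSet_ball) measurable_const) (by
      filter_upwards [hball.2.2 1 zero_le_one] with ω hω
      rw [(Φ ω).toMeasure_apply_eq_card measurableSet_ball Metric.isBounded_ball, Nat.cast_le]
      exact Nat.le_floor (by simpa using hω))
  have h2 := htransfer {φ | 1 ≤ φ.toMeasure (Metric.closedBall 0 τ)}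
    (measurableSet_le measurable_const (measurable_toMeasure_apply measurableSet_closedBall)) (by
      filter_upwards [hvoid.2] with ω hω
      rw [(Φ ω).toMeasure_apply_eq_card measurableSet_closedBall Metric.isBounded_closedBall]
      exact_mod_cast hω)
  filter_upwards [h1, h2] with ω hω1 hω2
  have e1 : (fun x : Plane => x - q) ⁻¹' Metric.ball 0 1 = Metric.ball q 1 := by
    ext x; simp [dist_eq_norm]
  have e2 : (fun x : Plane => x - q) ⁻¹' Metric.closedBall 0 τ = Metric.closedBall q τ := by
    ext x; simp [dist_eq_norm]
  rw [Config.toMeasure_translate_neg_apply _ _ measurableSet_ball, e1] at hω1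
  rw [Config.toMeasure_translate_neg_apply _ _ measurableSet_closedBall, e2] at hω2
  exact ⟨hω1, hω2⟩

/-- Regularity is invariant under translations and therefore passes to the Palm probability, under
which moreover the origin is almost surely a point. -/
theorem ae_palm_of_ae_mem_regularConfigs {μ : Measure Config} [SFinite μ] {N : ℕ} {t : ℝ}
    (h : ∀ᵐ φ ∂μ, φ ∈ regularConfigs N t) :
    ∀ᵐ φ ∂(palm μ), IsRegular (fun x : φ.points => (x : Plane)) N (t + 2) ∧ 0 ∈ φ.points := by
  let A : Set Config := regularConfigs N (t + 1) ∩ {φ | 1 ≤ φ.toMeasure {0}}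
  have hA : MeasurableSet A := (measurableSet_regularConfigs _ _).inter
    (measurableSet_le measurable_const (measurable_toMeasure_apply (measurableSet_singleton 0)))
  have hpalm : palm μ Aᶜ = 0 := by
    rw [palm_apply μ hA.compl, lintegral_eq_zero_of_ae_eq_zero, mul_zero]
    filter_upwards [h] with φ hφ
    refine ENNReal.tsum_eq_zero.2 fun x => ?_
    have hx : φ.translate (-x) ∈ A :=
      ⟨((isRegular_of_mem_regularConfigs hφ).translate _).mem_regularConfigs,
        (one_le_toMeasure_iff _ (measurableSet_singleton 0)).2 ⟨0, ⟨x, x.2.1, by simp⟩, rfl⟩⟩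
    exact Set.indicator_of_notMem (Set.notMem_compl_iff.2 hx) _
  have hae : ∀ᵐ φ ∂(palm μ), φ ∈ A := hpalm
  filter_upwards [hae] with φ hφ
  obtain ⟨x, hx, rfl⟩ := (one_le_toMeasure_iff _ (measurableSet_singleton 0)).1 hφ.2
  refine ⟨?_, hx⟩
  have := isRegular_of_mem_regularConfigs hφ.1
  rwa [add_assoc, one_add_one_eq_two] at this

/-! ### The backbone without fading -/

theorem hasBackbone_of_ae_mem_regularConfigs {μ : Measure Config} [SFinite μ] {N : ℕ} {t : ℝ}
    (ht : 0 < t) (h : ∀ᵐ φ ∂μ, φ ∈ regularConfigs N t) {ℓ : ℝ → ℝ} (hℓ : IsPathLoss ℓ) (W : ℝ≥0) :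
    ∃ θ₀ : ℝ, 0 < θ₀ ∧ ∀ θ : ℝ, 0 < θ → θ < θ₀ → HasBackbone μ ℓ W θ := by
  have hJ : N * latticePathLoss ℓ ≠ ∞ :=
    ENNReal.mul_ne_top (by simp) (latticePathLoss_lt_top hℓ).ne
  set R := t + 2 with hR
  have hR0 : 0 < R := by positivity
  obtain ⟨θ₀, hθ₀, hθ⟩ := exists_threshold hℓ one_pos (N * latticePathLoss ℓ).toNNReal W
    (D := 2 * R + 4 * R * 1) (by positivity)
  refine ⟨θ₀, hθ₀, fun θ h0 h1 => ⟨2 * R, by positivity, ?_⟩⟩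
  filter_upwards [ae_palm_of_ae_mem_regularConfigs h] with φ ⟨hreg, hzero⟩
  choose v hv using fun q => hreg.exists_near (gridPoint (2 * R) q)
  let w : ℤ × ℤ → φ.points := Function.update v 0 ⟨0, hzero⟩
  have hw : ∀ q, dist (w q : Plane) (gridPoint (2 * R) q) ≤ R := by
    intro q
    by_cases hq : q = 0
    · subst hq
      have : gridPoint (2 * R) 0 = 0 := by
        ext i; fin_cases i <;> simp [gridPoint]
      simp [w, this, hR0.le]
    · simp only [w, Function.update_of_ne hq]
      exact hv q
  have hinj : Function.Injective w :=
    injective_of_dist_gridPoint_le (pos := fun x : φ.points => (x : Plane)) hR0 hw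
  have hadj : ∀ q q' : ℤ × ℤ, q ≠ q' → |(q.1 - q'.1 : ℝ)| + |(q.2 - q'.2 : ℝ)| ≤ 1 →
      (sinrGraphNoFading ℓ W θ φ).Adj (w q) (w q') := by
    intro q q' hne hqq
    have hsum : ∀ y : φ.points, ∑' z, power ℓ (fun x : φ.points => (x : Plane)) (fun _ _ => 1) z y
        ≤ ((N * latticePathLoss ℓ).toNNReal : ℝ≥0∞) := by
      intro y
      rw [ENNReal.coe_toNNReal hJ]
      simpa [power] using hreg.tsum_pathLoss_le hℓ (y : Plane)
    exact sinrGraph_adj hℓ (hinj.ne hne) (dist_le_of_dist_gridPoint_le hR0.le (hw q) (hw q') hqq)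
      le_rfl le_rfl (hsum _) (hsum _) (hθ θ h0 h1)
  refine ⟨fun i j => w (i, j), congrArg Subtype.val (Function.update_self 0 _ v), fun i j => ?_,
    fun i j => ⟨?_, ?_, ?_, ?_⟩⟩
  · have h2 : R ≤ 2 * R := by linarith
    exact ⟨((abs_sub_apply_le_dist _ _ 0).trans (hw (i, j))).trans h2,
      ((abs_sub_apply_le_dist _ _ 1).trans (hw (i, j))).trans h2⟩
  all_goals exact hadj _ _ (by simp [eq_sub_iff_add_eq]) (by simp)

/-! ### Blocks of nodes and the fading variables they own -/

/-- The family of fading variables extended by `0` to the diagonal. -/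
noncomputable def offDiag (a : {p : ℕ × ℕ // p.1 ≠ p.2} → ℝ≥0) (m n : ℕ) : ℝ≥0 :=
  if h : m ≠ n then a ⟨(m, n), h⟩ else 0

theorem offDiag_of_ne (a : {p : ℕ × ℕ // p.1 ≠ p.2} → ℝ≥0) {m n : ℕ} (h : m ≠ n) :
    offDiag a m n = a ⟨(m, n), h⟩ := dif_pos h

/-- The two unit steps of the square lattice. -/
def unitStep (b : Bool) : ℤ × ℤ := if b then (0, 1) else (1, 0)

section Blocks

variable {M : ℕ} (node : ℤ × ℤ → Fin M ⊕ Bool → ℕ)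

/-- The four terminals of the block `Q`. Each block contributes `M` core nodes `node Q (inl k)` and
two terminals `node Q (inr b)`; the latter lies between the blocks `Q - unitStep b` and `Q` and is
shared by them. -/
def terminal (Q : ℤ × ℤ) (b c : Bool) : ℕ :=
  node (if c then Q + unitStep b else Q) (Sum.inr b)

/-- The receivers that matter for the block `Q`: its core nodes and its four terminals. -/
def receiver (Q : ℤ × ℤ) : Fin M ⊕ Bool × Bool → ℕ :=
  Sum.elim (fun k => node Q (Sum.inl k)) fun bc => terminal node Q bc.1 bc.2

open Classical in
/-- The block that owns the fading variable from `p.1` to `p.2`. A block owns all variables received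
by its core nodes; a variable received by a terminal between two blocks is owned by the first block
if it is sent by a core node of that block, and by the second block otherwise. Variables received by
other nodes play no role. -/
noncomputable def owner (p : ℕ × ℕ) : ℤ × ℤ :=
  match Function.invFun (Function.uncurry node) p.2 with
  | (Q, Sum.inl _) => Q
  | (Q, Sum.inr b) => if ∃ k, p.1 = node (Q - unitStep b) (Sum.inl k) then Q - unitStep b else Q

variable {node}

theorem owner_core (hnode : Function.Injective (Function.uncurry node)) (z : ℕ) (Q : ℤ × ℤ)
    (k : Fin M) : owner node (z, node Q (Sum.inl k)) = Q := by
  have h : Function.invFun (Function.uncurry node) (node Q (Sum.inl k)) = (Q, Sum.inl k) :=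
    Function.leftInverse_invFun hnode (Q, Sum.inl k)
  simp only [owner, h]

open Classical in
theorem owner_inr (hnode : Function.Injective (Function.uncurry node)) (z : ℕ) (Q : ℤ × ℤ)
    (b : Bool) : owner node (z, node Q (Sum.inr b))
      = if ∃ k, z = node (Q - unitStep b) (Sum.inl k) then Q - unitStep b else Q := by
  have h : Function.invFun (Function.uncurry node) (node Q (Sum.inr b)) = (Q, Sum.inr b) :=
    Function.leftInverse_invFun hnode (Q, Sum.inr b)
  simp only [owner, h]

theorem node_inl_injective (hnode : Function.Injective (Function.uncurry node)) {Q Q' : ℤ × ℤ}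
    {k k' : Fin M} (h : node Q (Sum.inl k) = node Q' (Sum.inl k')) : Q = Q' ∧ k = k' := by
  have := @hnode (Q, Sum.inl k) (Q', Sum.inl k') h
  simpa using this

theorem node_inl_ne_inr (hnode : Function.Injective (Function.uncurry node)) {Q Q' : ℤ × ℤ}
    {k : Fin M} {b : Bool} : node Q (Sum.inl k) ≠ node Q' (Sum.inr b) := by
  intro h
  have := @hnode (Q, Sum.inl k) (Q', Sum.inr b) h
  simp at this

theorem unitStep_ne_zero (b : Bool) : unitStep b ≠ 0 := by
  cases b <;> simp [unitStep, Prod.ext_iff]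

theorem owner_core_terminal (hnode : Function.Injective (Function.uncurry node)) (Q : ℤ × ℤ)
    (k : Fin M) (b c : Bool) : owner node (node Q (Sum.inl k), terminal node Q b c) = Q := by
  classical
  rw [terminal, owner_inr hnode]
  cases c
  · rw [if_neg]
    · simp
    rintro ⟨k', hk'⟩
    have h : Q = Q - unitStep b := by simpa using (node_inl_injective hnode hk').1
    exact unitStep_ne_zero b (sub_eq_self.1 h.symm)
  · rw [if_pos ⟨k, by simp⟩]
    simp

/-! ### Good blocks -/

variable (node) (ℓ : ℝ → ℝ) (pos : ℕ → Plane)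

/-- The part of the total power received at `y` that is due to fading variables owned by `Q`. -/
noncomputable def ownedPower (a : {p : ℕ × ℕ // p.1 ≠ p.2} → ℝ≥0) (Q : ℤ × ℤ) (y : ℕ) : ℝ≥0∞ :=
  ∑' z, if owner node (z, y) = Q then power ℓ pos (offDiag a) z y else 0

/-- Both fading variables between a core node of `Q` and each of the four terminals of `Q` exceed
`ε`, so that this core node can serve as the hub of the block. -/
def IsHub (a : {p : ℕ × ℕ // p.1 ≠ p.2} → ℝ≥0) (ε : ℝ≥0) (Q : ℤ × ℤ) (k : Fin M) : Prop :=
  ∀ b c, ε < offDiag a (node Q (Sum.inl k)) (terminal node Q b c) ∧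
    ε < offDiag a (terminal node Q b c) (node Q (Sum.inl k))

/-- A block is bad if it has no hub, or if the owned power at one of its receivers exceeds `K`. -/
def IsBadBlock (a : {p : ℕ × ℕ // p.1 ≠ p.2} → ℝ≥0) (ε K : ℝ≥0) (Q : ℤ × ℤ) : Prop :=
  (∀ k, ¬ IsHub node a ε Q k) ∨ ∃ r, (K : ℝ≥0∞) < ownedPower node ℓ pos a Q (receiver node Q r)

variable {node ℓ pos}

theorem tsum_power_core_eq (hnode : Function.Injective (Function.uncurry node))
    (a : {p : ℕ × ℕ // p.1 ≠ p.2} → ℝ≥0) (Q : ℤ × ℤ) (k : Fin M) :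
    ∑' z, power ℓ pos (offDiag a) z (node Q (Sum.inl k))
      = ownedPower node ℓ pos a Q (node Q (Sum.inl k)) := by
  simp [ownedPower, owner_core hnode]

theorem tsum_power_terminal_le (hnode : Function.Injective (Function.uncurry node))
    (a : {p : ℕ × ℕ // p.1 ≠ p.2} → ℝ≥0) (Q : ℤ × ℤ) (b : Bool) :
    ∑' z, power ℓ pos (offDiag a) z (terminal node Q b true)
      ≤ ownedPower node ℓ pos a Q (terminal node Q b true) +
        ownedPower node ℓ pos a (Q + unitStep b) (terminal node Q b true) := by
  classical
  rw [ownedPower, ownedPower, ← ENNReal.tsum_add]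
  refine ENNReal.tsum_le_tsum fun z => ?_
  rw [terminal, if_pos rfl, owner_inr hnode, add_sub_cancel_right]
  by_cases h : ∃ k, z = node Q (Sum.inl k)
  · rw [if_pos h, if_pos rfl]; exact le_self_add
  · rw [if_neg h, if_pos (c := Q + unitStep b = Q + unitStep b) rfl]; exact le_add_self

theorem terminal_add_unitStep_false (Q : ℤ × ℤ) (b : Bool) :
    terminal node (Q + unitStep b) b false = terminal node Q b true := by
  simp [terminal]

/-- The hubs of neighbouring good blocks are joined through the terminal between these blocks. The
interference at this terminal is controlled because both blocks are good. -/
theorem reachable_of_good (hnode : Function.Injective (Function.uncurry node))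
    (hℓ : IsPathLoss ℓ) {W ε K : ℝ≥0} {D θ : ℝ}
    (hD : ∀ Q k b c, dist (pos (node Q (Sum.inl k))) (pos (terminal node Q b c)) ≤ D)
    (hθ : ENNReal.ofReal θ * ((2 * K : ℝ≥0) + W) < ε * ENNReal.ofReal (ℓ D))
    {a : {p : ℕ × ℕ // p.1 ≠ p.2} → ℝ≥0} {Q : ℤ × ℤ} {b : Bool} {k k' : Fin M}
    (hQ : ¬ IsBadBlock node ℓ pos a ε K Q) (hQ' : ¬ IsBadBlock node ℓ pos a ε K (Q + unitStep b))
    (hk : IsHub node a ε Q k) (hk' : IsHub node a ε (Q + unitStep b) k') :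
    (sinrGraph ℓ W pos (offDiag a) θ).Reachable (node Q (Sum.inl k))
      (node (Q + unitStep b) (Sum.inl k')) := by
  have hpow : ∀ {Q}, ¬ IsBadBlock node ℓ pos a ε K Q → ∀ r,
      ownedPower node ℓ pos a Q (receiver node Q r) ≤ K := fun h r =>
    not_lt.1 fun hr => h (Or.inr ⟨r, hr⟩)
  have hle : (K : ℝ≥0∞) ≤ (2 * K : ℝ≥0) := by
    rw [ENNReal.coe_le_coe, two_mul]; exact le_self_add
  have hcore : ∀ {Q}, ¬ IsBadBlock node ℓ pos a ε K Q → ∀ k,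
      ∑' z, power ℓ pos (offDiag a) z (node Q (Sum.inl k)) ≤ (2 * K : ℝ≥0) := fun h k =>
    (tsum_power_core_eq hnode a _ k).le.trans ((hpow h (Sum.inl k)).trans hle)
  have hterm : ∑' z, power ℓ pos (offDiag a) z (terminal node Q b true) ≤ (2 * K : ℝ≥0) := by
    refine (tsum_power_terminal_le hnode a Q b).trans ?_
    rw [two_mul, ENNReal.coe_add]
    have h := hpow hQ' (Sum.inr (b, false))
    rw [receiver, Sum.elim_inr, terminal_add_unitStep_false] at h
    exact add_le_add (hpow hQ (Sum.inr (b, true))) h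
  have h1 : (sinrGraph ℓ W pos (offDiag a) θ).Adj (node Q (Sum.inl k)) (terminal node Q b true) :=
    sinrGraph_adj hℓ (node_inl_ne_inr hnode) (hD Q k b true) (hk b true).1.le (hk b true).2.le
      hterm (hcore hQ k) hθ
  have h2 : (sinrGraph ℓ W pos (offDiag a) θ).Adj (node (Q + unitStep b) (Sum.inl k'))
      (terminal node (Q + unitStep b) b false) :=
    sinrGraph_adj (y := terminal node (Q + unitStep b) b false) hℓ (node_inl_ne_inr hnode) (hD _ k' b false)
      (hk' b false).1.le
      (hk' b false).2.le (by rwa [terminal_add_unitStep_false]) (hcore hQ' k') hθ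
  rw [terminal_add_unitStep_false] at h2
  exact h1.reachable.trans h2.reachable.symm

theorem percolates_iff {ι : Type*} (G : SimpleGraph ι) :
    Percolates G ↔ ∃ x, {y | G.Reachable x y}.Infinite := by
  constructor
  · rintro ⟨c, hc⟩
    induction c using SimpleGraph.ConnectedComponent.ind with
    | h x =>
      refine ⟨x, hc.mono fun y hy => ?_⟩
      exact (SimpleGraph.ConnectedComponent.exact hy).symm
  · rintro ⟨x, hx⟩
    refine ⟨G.connectedComponentMk x, hx.mono fun y hy => ?_⟩
    exact SimpleGraph.ConnectedComponent.sound (SimpleGraph.Reachable.symm hy)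

/-- If large blocks around the origin are good in the hierarchical sense, then the SINR graph
percolates. -/
theorem percolates_of_eventually_notMem_badBlocks
    (hnode : Function.Injective (Function.uncurry node)) (hM : 0 < M)
    (hℓ : IsPathLoss ℓ) {W ε K : ℝ≥0} {D θ : ℝ}
    (hD : ∀ Q k b c, dist (pos (node Q (Sum.inl k))) (pos (terminal node Q b c)) ≤ D)
    (hθ : ENNReal.ofReal θ * ((2 * K : ℝ≥0) + W) < ε * ENNReal.ofReal (ℓ D))
    {a : {p : ℕ × ℕ // p.1 ≠ p.2} → ℝ≥0}
    (h : ∀ᶠ n in Filter.atTop, (0 : ℤ × ℤ) ∉ badBlocks {Q | IsBadBlock node ℓ pos a ε K Q} n) :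
    Percolates (sinrGraph ℓ W pos (offDiag a) θ) := by
  have hhub : ∀ Q, ∃ k, ¬ IsBadBlock node ℓ pos a ε K Q → IsHub node a ε Q k := by
    intro Q
    by_cases hQ : IsBadBlock node ℓ pos a ε K Q
    · exact ⟨⟨0, hM⟩, fun h => (h hQ).elim⟩
    · by_contra! hk
      exact hQ (Or.inl fun k => (hk k).2)
  choose hub hhub using hhub
  let u : ℤ × ℤ → ℕ := fun Q => node Q (Sum.inl (hub Q))
  have hu : Function.Injective u := fun Q Q' h => (node_inl_injective hnode h).1
  let R : ℤ × ℤ → ℤ × ℤ → Prop := fun Q Q' =>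
    (sinrGraph ℓ W pos (offDiag a) θ).Reachable (u Q) (u Q')
  have hR : Equivalence R := ⟨fun _ => .refl _, fun h => h.symm, fun h h' => h.trans h'⟩
  have hstep : ∀ Q b, ¬ IsBadBlock node ℓ pos a ε K Q →
      ¬ IsBadBlock node ℓ pos a ε K (Q + unitStep b) → R Q (Q + unitStep b) :=
    fun Q b h h' => reachable_of_good hnode hℓ hD hθ h h' (hhub _ h) (hhub _ h')
  obtain ⟨Q, hQ⟩ := exists_infinite_class hR
    (fun x y h h' => by
      have := hstep (x, y) false h (by simpa [unitStep] using h')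
      simpa [unitStep] using this)
    (fun x y h h' => by
      have := hstep (x, y) true h (by simpa [unitStep] using h')
      simpa [unitStep] using this) h
  refine (percolates_iff _).2 ⟨u Q, (hQ.image hu.injOn).mono ?_⟩
  rintro _ ⟨Q', h, rfl⟩
  exact h

end Blocks

/-- Among the nodes near the points of a square lattice one can choose the cores and terminals of
all blocks, within bounded distance of each other. -/
theorem IsRegular.exists_blocks {pos : ℕ → Plane} {N : ℕ} {R : ℝ} (hpos : IsRegular pos N R)
    (hR : 0 < R) (M : ℕ) :
    ∃ node : ℤ × ℤ → Fin M ⊕ Bool → ℕ, Function.Injective (Function.uncurry node) ∧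
      ∀ Q k b c, dist (pos (node Q (Sum.inl k))) (pos (terminal node Q b c))
        ≤ 2 * R + 4 * R * (2 * M + 4) := by
  choose v hv using fun q => hpos.exists_near (gridPoint (2 * R) q)
  have hinj := injective_of_dist_gridPoint_le hR hv
  let off : Fin M ⊕ Bool → ℤ := Sum.elim (fun k => (k : ℤ)) fun b => if b then M + 1 else M
  have hoff : ∀ s, 0 ≤ off s ∧ off s < M + 2 := by
    rintro (k | b)
    · simp only [off, Sum.elim_inl]; omega
    · have h : off (Sum.inr b) = M ∨ off (Sum.inr b) = M + 1 := by cases b <;> simp [off]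
      omega
  have hoff_inj : Function.Injective off := by
    rintro (k | b) (k' | b') h
    · simp only [off, Sum.elim_inl] at h
      congr 1; ext; omega
    · have := k.2
      cases b' <;> simp [off] at h <;> omega
    · have := k'.2
      cases b <;> simp [off] at h <;> omega
    · cases b <;> cases b' <;> simp [off] at h ⊢
  refine ⟨fun Q s => v ((M + 2) * Q.1 + off s, Q.2), ?_, fun Q k b c => ?_⟩
  · rintro ⟨Q, s⟩ ⟨Q', s'⟩ h
    have h' := hinj h
    simp only [Prod.mk.injEq] at h'
    obtain ⟨h1, h2⟩ := h'
    obtain ⟨hs0, hs1⟩ := hoff s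
    obtain ⟨hs0', hs1'⟩ := hoff s'
    have hM : (0 : ℤ) < M + 2 := by positivity
    -- quotient and remainder of the division by `M + 2`
    have hdiv : ∀ x y : ℤ, 0 ≤ y → y < M + 2 → ((M + 2) * x + y) / (M + 2) = x := by
      intro x y h0 hlt
      rw [add_comm, Int.add_mul_ediv_left _ _ hM.ne', Int.ediv_eq_zero_of_lt h0 hlt, zero_add]
    have hq : Q.1 = Q'.1 := by
      rw [← hdiv Q.1 _ hs0 hs1, h1, hdiv Q'.1 _ hs0' hs1']
    rw [hq] at h1
    exact Prod.ext (Prod.ext hq h2) (hoff_inj (add_left_cancel h1))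
  · refine dist_le_of_dist_gridPoint_le hR.le (hv _) (hv _) ?_
    obtain ⟨hs0, hs1⟩ := hoff (Sum.inl k)
    obtain ⟨ht0, ht1⟩ := hoff (Sum.inr b)
    set s := off (Sum.inl k)
    set t := off (Sum.inr b)
    have key : ∀ i j : ℤ, 0 ≤ i → i ≤ 1 → 0 ≤ j → j ≤ 1 →
        |((((M + 2) * Q.1 + s : ℤ) : ℝ) - (((M + 2) * (Q.1 + i) + t : ℤ) : ℝ))| +
        |((Q.2 : ℝ) - ((Q.2 + j : ℤ) : ℝ))| ≤ 2 * M + 4 := by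
      intro i j hi hi' hj hj'
      have h : |((M + 2) * Q.1 + s : ℤ) - ((M + 2) * (Q.1 + i) + t)| + |Q.2 - (Q.2 + j)|
          ≤ 2 * M + 4 := by
        have e1 : ((M + 2) * Q.1 + s : ℤ) - ((M + 2) * (Q.1 + i) + t) = s - t - (M + 2) * i := by
          ring
        have e2 : Q.2 - (Q.2 + j) = -j := by ring
        have h3 : |s - t - (M + 2) * i| ≤ 2 * M + 3 := by
          have hb0 : 0 ≤ (M + 2 : ℤ) * i := by positivity
          have hb1 : (M + 2 : ℤ) * i ≤ M + 2 := by nlinarith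
          rw [abs_le]; constructor <;> omega
        rw [e1, e2, abs_neg, abs_of_nonneg hj]
        omega
      exact_mod_cast h
    cases b <;> cases c
    · simpa using key 0 0 (by simp) (by simp) (by simp) (by simp)
    · simpa [unitStep] using key 1 0 (by simp) (by simp) (by simp) (by simp)
    · simpa using key 0 0 (by simp) (by simp) (by simp) (by simp)
    · simpa [unitStep] using key 0 1 (by simp) (by simp) (by simp) (by simp)

/-! ### The probability that a block is bad -/

theorem measurableSet_setOf_forall {α ι : Type*} {m : MeasurableSpace α} [Countable ι]
    {p : ι → α → Prop} (h : ∀ i, MeasurableSet {x | p i x}) : MeasurableSet {x | ∀ i, p i x} := by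
  rw [Set.ofPred_forall]
  exact .iInter h

theorem measurableSet_setOf_exists {α ι : Type*} {m : MeasurableSpace α} [Countable ι]
    {p : ι → α → Prop} (h : ∀ i, MeasurableSet {x | p i x}) : MeasurableSet {x | ∃ i, p i x} := by
  rw [Set.ofPred_exists]
  exact .iUnion h

section Measurability

variable {Ω : Type*} [MeasurableSpace Ω] {M : ℕ} {node : ℤ × ℤ → Fin M ⊕ Bool → ℕ}
  {ℓ : ℝ → ℝ} {pos : ℕ → Plane} {H : {p : ℕ × ℕ // p.1 ≠ p.2} → Ω → ℝ≥0}

theorem measurable_offDiag {m n : ℕ} (h : ∀ hmn : m ≠ n, Measurable (H ⟨(m, n), hmn⟩)) :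
    Measurable fun ω => offDiag (fun p => H p ω) m n := by
  by_cases hmn : m = n
  · simp [offDiag, hmn]
  · simpa [offDiag, hmn] using h hmn

theorem measurable_ownedPower {Q : ℤ × ℤ} (hH : ∀ p, owner node p.1 = Q → Measurable (H p))
    (y : ℕ) :
    Measurable fun ω => ownedPower node ℓ pos (fun p => H p ω) Q y := by
  refine Measurable.tsum fun z => ?_
  by_cases h : owner node (z, y) = Q
  · simp only [if_pos h, power]
    exact (measurable_offDiag fun hzy => hH _ h).coe_nnreal_ennreal.mul_const _
  · simp only [if_neg h]
    exact measurable_const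

theorem measurableSet_isHub {Q : ℤ × ℤ} {k : Fin M}
    (hH : ∀ b c, ∀ h, Measurable (H ⟨(node Q (Sum.inl k), terminal node Q b c), h⟩))
    (hH' : ∀ b c, ∀ h, Measurable (H ⟨(terminal node Q b c, node Q (Sum.inl k)), h⟩)) (ε : ℝ≥0) :
    MeasurableSet {ω | IsHub node (fun p => H p ω) ε Q k} := by
  refine measurableSet_setOf_forall fun b => measurableSet_setOf_forall fun c => ?_
  have h1 : MeasurableSet
      {ω | ε < offDiag (fun p => H p ω) (node Q (Sum.inl k)) (terminal node Q b c)} :=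
    measurableSet_lt measurable_const (measurable_offDiag (hH b c))
  have h2 : MeasurableSet
      {ω | ε < offDiag (fun p => H p ω) (terminal node Q b c) (node Q (Sum.inl k))} :=
    measurableSet_lt measurable_const (measurable_offDiag (hH' b c))
  exact h1.inter h2

theorem measurableSet_isBadBlock (hnode : Function.Injective (Function.uncurry node)) {Q : ℤ × ℤ}
    (hH : ∀ p, owner node p.1 = Q → Measurable (H p)) (ε K : ℝ≥0) :
    MeasurableSet {ω | IsBadBlock node ℓ pos (fun p => H p ω) ε K Q} := by
  refine MeasurableSet.union ?_ ?_
  · refine measurableSet_setOf_forall fun k => (measurableSet_isHub ?_ ?_ ε).compl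
    · exact fun b c h => hH _ (owner_core_terminal hnode Q k b c)
    · exact fun b c h => hH _ (owner_core hnode _ Q k)
  · exact measurableSet_setOf_exists fun r =>
      measurableSet_lt measurable_const (measurable_ownedPower hH _)

end Measurability

/-- Events that depend on disjoint groups of independent σ-algebras are independent. -/
theorem measure_biInter_le_pow {Ω κ β : Type*} [mΩ : MeasurableSpace Ω] {P : Measure Ω}
    [IsProbabilityMeasure P] {m : κ → MeasurableSpace Ω} (hm : ∀ k, m k ≤ mΩ) (hind : iIndep m P)
    {S : β → Set κ} (hS : Pairwise (Function.onFun Disjoint S)) {A : β → Set Ω}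
    (hA : ∀ b, MeasurableSet[⨆ k ∈ S b, m k] (A b)) {r : ℝ≥0∞} (hr : ∀ b, P (A b) ≤ r)
    (s : Finset β) : P (⋂ b ∈ s, A b) ≤ r ^ s.card := by
  classical
  induction s using Finset.induction_on with
  | empty => simp
  | insert a s ha ih =>
    have hdisj : Disjoint (S a) (⋃ b ∈ s, S b) := by
      rw [Set.disjoint_iUnion₂_right]
      exact fun b hb => hS fun h => ha (h ▸ hb)
    have hI := (Indep_iff _ _ _).1 (indep_iSup_of_disjoint hm hind hdisj) (A a) (⋂ b ∈ s, A b)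
      (hA a) (Finset.measurableSet_biInter _ fun b hb =>
        (biSup_mono (Set.subset_biUnion_of_mem (u := S) hb) :
          (⨆ k ∈ S b, m k) ≤ ⨆ k ∈ ⋃ b ∈ s, S b, m k) _ (hA b))
    rw [Finset.set_biInter_insert, hI, Finset.card_insert_of_notMem ha, pow_succ']
    exact mul_le_mul' (hr a) ih

section Probability

variable {Ω : Type*} [mΩ : MeasurableSpace Ω] {P : Measure Ω}
  {M : ℕ} {node : ℤ × ℤ → Fin M ⊕ Bool → ℕ} {H : {p : ℕ × ℕ // p.1 ≠ p.2} → Ω → ℝ≥0}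

theorem le_measure_isHub (hnode : Function.Injective (Function.uncurry node))
    (hind : iIndepFun H P) {ε : ℝ≥0} {q : ℝ≥0∞}
    (hq : ∀ p, q ≤ P {ω | ε < H p ω}) (hq1 : q ≤ 1) (Q : ℤ × ℤ) (k : Fin M) :
    q ^ 8 ≤ P {ω | IsHub node (fun p => H p ω) ε Q k} := by
  classical
  have hne : ∀ b c, node Q (Sum.inl k) ≠ terminal node Q b c := fun b c => node_inl_ne_inr hnode
  let pair : Bool × Bool × Bool → {p : ℕ × ℕ // p.1 ≠ p.2} := fun x =>
    if x.2.2 then ⟨(node Q (Sum.inl k), terminal node Q x.1 x.2.1), hne _ _⟩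
    else ⟨(terminal node Q x.1 x.2.1, node Q (Sum.inl k)), (hne _ _).symm⟩
  have hset : {ω | IsHub node (fun p => H p ω) ε Q k}
      = ⋂ p ∈ Finset.univ.image pair, H p ⁻¹' Set.Ioi ε := by
    ext ω
    rw [Set.mem_iInter₂, Finset.forall_mem_image]
    constructor
    · rintro h ⟨b, c, d⟩ -
      have := h b c
      rw [offDiag_of_ne _ (hne b c), offDiag_of_ne _ (hne b c).symm] at this
      cases d
      · exact this.2
      · exact this.1
    · intro h b c
      rw [offDiag_of_ne _ (hne b c), offDiag_of_ne _ (hne b c).symm]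
      exact ⟨h (Finset.mem_univ (b, c, true)), h (Finset.mem_univ (b, c, false))⟩
  rw [hset, hind.measure_inter_preimage_eq_mul _ (fun _ _ => measurableSet_Ioi)]
  -- there is no need to know that the eight pairs are distinct, as `q ≤ 1`
  have hcard : (Finset.univ.image pair).card ≤ 8 := Finset.card_image_le.trans (by simp)
  calc q ^ 8 ≤ q ^ (Finset.univ.image pair).card := pow_le_pow_right_of_le_one' hq1 hcard
    _ = ∏ _p ∈ Finset.univ.image pair, q := by rw [Finset.prod_const]
    _ ≤ _ := Finset.prod_le_prod' fun p _ => hq p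

/-- The `M` candidates for the hub of a block depend on disjoint sets of fading variables. -/
theorem measure_no_hub_le [IsProbabilityMeasure P]
    (hnode : Function.Injective (Function.uncurry node))
    (hmeas : ∀ p, Measurable (H p)) (hind : iIndepFun H P) {ε : ℝ≥0} {q : ℝ≥0∞}
    (hq : ∀ p, q ≤ P {ω | ε < H p ω}) (hq1 : q ≤ 1) (Q : ℤ × ℤ) :
    P {ω | ∀ k, ¬ IsHub node (fun p => H p ω) ε Q k} ≤ (1 - q ^ 8) ^ M := by
  let S : Fin M → Set {p : ℕ × ℕ // p.1 ≠ p.2} := fun k => {p |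
    (p.1.1 = node Q (Sum.inl k) ∧ ∃ Q' b, p.1.2 = node Q' (Sum.inr b)) ∨
    (p.1.2 = node Q (Sum.inl k) ∧ ∃ Q' b, p.1.1 = node Q' (Sum.inr b))}
  have hS : Pairwise (Function.onFun Disjoint S) := by
    intro k k' hkk'
    refine Set.disjoint_left.2 ?_
    rintro ⟨⟨x, y⟩, hxy⟩ (⟨h1, Q', b, h2⟩ | ⟨h1, Q', b, h2⟩) (⟨h3, Q'', b', h4⟩ | ⟨h3, Q'', b', h4⟩)
    · exact hkk' (node_inl_injective hnode (h1.symm.trans h3)).2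
    · exact node_inl_ne_inr hnode (h1.symm.trans h4)
    · exact node_inl_ne_inr hnode (h1.symm.trans h4)
    · exact hkk' (node_inl_injective hnode (h1.symm.trans h3)).2
  have hmS : ∀ k p, p ∈ S k → Measurable[⨆ p ∈ S k, MeasurableSpace.comap (H p) inferInstance]
      (H p) := fun k p hp =>
    (comap_measurable (H p)).mono
      (le_biSup (fun p => MeasurableSpace.comap (H p) inferInstance) hp) le_rfl
  have hA : ∀ k, MeasurableSet[⨆ p ∈ S k, MeasurableSpace.comap (H p) inferInstance]
      {ω | IsHub node (fun p => H p ω) ε Q k}ᶜ := fun k =>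
    (@measurableSet_isHub Ω (⨆ p ∈ S k, MeasurableSpace.comap (H p) inferInstance) M node H Q k
      (fun b c h => hmS k _ (Or.inl ⟨rfl, _, b, rfl⟩))
      (fun b c h => hmS k _ (Or.inr ⟨rfl, _, b, rfl⟩)) ε).compl
  have hr : ∀ k, P {ω | IsHub node (fun p => H p ω) ε Q k}ᶜ ≤ 1 - q ^ 8 := fun k => by
    rw [prob_compl_eq_one_sub (measurableSet_isHub (fun _ _ _ => hmeas _) (fun _ _ _ => hmeas _) ε)]
    exact tsub_le_tsub_left (le_measure_isHub hnode hind hq hq1 Q k) 1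
  have h := measure_biInter_le_pow (fun p => (hmeas p).comap_le) hind.iIndep hS hA hr Finset.univ
  rw [Finset.card_univ, Fintype.card_fin] at h
  refine le_trans (measure_mono fun ω hω => ?_) h
  exact Set.mem_iInter₂.2 fun k _ => hω k

theorem lintegral_ownedPower_le {ℓ : ℝ → ℝ} (hℓ : IsPathLoss ℓ) {pos : ℕ → Plane} {N : ℕ} {R : ℝ}
    (hpos : IsRegular pos N R) (hmeas : ∀ p, Measurable (H p)) {C : ℝ≥0∞}
    (hC : ∀ p, ∫⁻ ω, H p ω ∂P ≤ C) (Q : ℤ × ℤ) (y : ℕ) :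
    ∫⁻ ω, ownedPower node ℓ pos (fun p => H p ω) Q y ∂P ≤ C * (N * latticePathLoss ℓ) := by
  have hm : ∀ z, Measurable fun ω => (offDiag (fun p => H p ω) z y : ℝ≥0∞) := fun z =>
    (measurable_offDiag fun _ => hmeas _).coe_nnreal_ennreal
  calc ∫⁻ ω, ownedPower node ℓ pos (fun p => H p ω) Q y ∂P
      ≤ ∫⁻ ω, ∑' z, offDiag (fun p => H p ω) z y *
          ENNReal.ofReal (ℓ (dist (pos z) (pos y))) ∂P := by
        refine lintegral_mono fun ω => ENNReal.tsum_le_tsum fun z => ?_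
        split_ifs
        · exact le_rfl
        · exact zero_le
    _ = ∑' z, (∫⁻ ω, offDiag (fun p => H p ω) z y ∂P) *
          ENNReal.ofReal (ℓ (dist (pos z) (pos y))) := by
        rw [lintegral_tsum fun z => ((hm z).mul_const _).aemeasurable]
        exact tsum_congr fun z => lintegral_mul_const _ (hm z)
    _ ≤ ∑' z, C * ENNReal.ofReal (ℓ (dist (pos z) (pos y))) := by
        refine ENNReal.tsum_le_tsum fun z => mul_le_mul_left ?_ _
        by_cases hzy : z = y
        · simp [offDiag, hzy]
        · simpa [offDiag, hzy] using hC ⟨(z, y), hzy⟩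
    _ ≤ C * (N * latticePathLoss ℓ) := by
        rw [ENNReal.tsum_mul_left]
        gcongr
        exact hpos.tsum_pathLoss_le hℓ (pos y)

theorem measure_isBadBlock_le [IsProbabilityMeasure P]
    (hnode : Function.Injective (Function.uncurry node))
    (hmeas : ∀ p, Measurable (H p)) (hind : iIndepFun H P) {ε : ℝ≥0} {q : ℝ≥0∞}
    (hq : ∀ p, q ≤ P {ω | ε < H p ω}) (hq1 : q ≤ 1)
    {ℓ : ℝ → ℝ} (hℓ : IsPathLoss ℓ) {pos : ℕ → Plane} {N : ℕ} {R : ℝ}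
    (hpos : IsRegular pos N R) {C : ℝ≥0∞} (hC : ∀ p, ∫⁻ ω, H p ω ∂P ≤ C) {K : ℝ≥0} (hK : 0 < K)
    (Q : ℤ × ℤ) :
    P {ω | IsBadBlock node ℓ pos (fun p => H p ω) ε K Q}
      ≤ (1 - q ^ 8) ^ M + (M + 4 : ℕ) * (C * (N * latticePathLoss ℓ) / K) := by
  refine (measure_union_le (μ := P) {ω | ∀ k, ¬ IsHub node (fun p => H p ω) ε Q k}
    {ω | ∃ r, (K : ℝ≥0∞) < ownedPower node ℓ pos (fun p => H p ω) Q (receiver node Q r)}).trans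
    (add_le_add (measure_no_hub_le hnode hmeas hind hq hq1 Q) ?_)
  have hset : {ω | ∃ r, (K : ℝ≥0∞) < ownedPower node ℓ pos (fun p => H p ω) Q (receiver node Q r)}
      = ⋃ r, {ω | (K : ℝ≥0∞) < ownedPower node ℓ pos (fun p => H p ω) Q (receiver node Q r)} := by
    ext ω; rw [Set.mem_iUnion]; rfl
  rw [hset]
  refine (measure_iUnion_fintype_le P _).trans ?_
  calc _ ≤ ∑ _r : Fin M ⊕ Bool × Bool, C * (N * latticePathLoss ℓ) / K := by
        refine Finset.sum_le_sum fun r _ => ?_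
        have hlt : {ω | (K : ℝ≥0∞) < ownedPower node ℓ pos (fun p => H p ω) Q (receiver node Q r)} ⊆
            {ω | (K : ℝ≥0∞) ≤ ownedPower node ℓ pos (fun p => H p ω) Q (receiver node Q r)} :=
          fun ω hω => le_of_lt (α := ℝ≥0∞) hω
        refine (measure_mono hlt).trans ((meas_ge_le_lintegral_div
          (measurable_ownedPower (fun p _ => hmeas p) _).aemeasurable (by simpa using hK.ne')
          ENNReal.coe_ne_top).trans ?_)
        gcongr
        exact lintegral_ownedPower_le hℓ hpos hmeas hC Q _
    _ = _ := by
        rw [Finset.sum_const, Finset.card_univ, nsmul_eq_mul]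
        simp

/-- The number `M` of candidates for the hub of a block, and then the bound `K` for the owned power,
can be chosen such that blocks are good with high probability. The threshold depends on the node
positions only through their regularity constants. -/
theorem exists_threshold_forall_ae_percolates [IsProbabilityMeasure P]
    (hmeas : ∀ p, Measurable (H p)) (hind : iIndepFun H P) {ε : ℝ≥0} (hε : 0 < ε) {q : ℝ≥0∞} (hq0 : q ≠ 0)
    (hq : ∀ p, q ≤ P {ω | ε < H p ω}) {C : ℝ≥0∞} (hC0 : C ≠ ∞) (hC : ∀ p, ∫⁻ ω, H p ω ∂P ≤ C)
    {ℓ : ℝ → ℝ} (hℓ : IsPathLoss ℓ) (W : ℝ≥0) (N : ℕ) {R : ℝ} (hR : 0 < R) :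
    ∃ θ₀ : ℝ, 0 < θ₀ ∧ ∀ θ : ℝ, 0 < θ → θ < θ₀ → ∀ pos : ℕ → Plane, IsRegular pos N R →
      ∀ᵐ ω ∂P, Percolates (sinrGraph ℓ W pos (offDiag fun p => H p ω) θ) := by
  have hq1 : q ≤ 1 := (hq ⟨(0, 1), by simp⟩).trans prob_le_one
  obtain ⟨M, hM0, hM⟩ : ∃ M : ℕ, 0 < M ∧ (1 - q ^ 8) ^ M ≤ (288 : ℝ≥0∞)⁻¹ := by
    have hlt : 1 - q ^ 8 < 1 :=
      ENNReal.sub_lt_self ENNReal.one_ne_top one_ne_zero (pow_ne_zero _ hq0)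
    have := (ENNReal.tendsto_pow_atTop_nhds_zero_of_lt_one hlt).eventually
      (ge_mem_nhds (ENNReal.inv_pos.2 (ENNReal.natCast_ne_top 288)))
    obtain ⟨M, h1, h2⟩ := (this.and (Filter.eventually_gt_atTop 0)).exists
    exact ⟨M, h2, h1⟩
  set T := (M + 4 : ℕ) * (C * (N * latticePathLoss ℓ)) with hT
  have hT_top : T ≠ ∞ := ENNReal.mul_ne_top (by simp) (ENNReal.mul_ne_top hC0
    (ENNReal.mul_ne_top (by simp) (latticePathLoss_lt_top hℓ).ne))
  let K : ℝ≥0 := 288 * T.toNNReal + 1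
  have hK : (M + 4 : ℕ) * (C * (N * latticePathLoss ℓ) / K) ≤ (288 : ℝ≥0∞)⁻¹ := by
    rw [← mul_div_assoc, ← hT]
    refine ENNReal.div_le_of_le_mul ?_
    have : (K : ℝ≥0∞) = 288 * T + 1 := by
      simp [K, ENNReal.coe_toNNReal hT_top]
    rw [this, mul_add, ← mul_assoc, ENNReal.inv_mul_cancel (by simp) (by simp), one_mul]
    exact le_self_add
  obtain ⟨θ₀, hθ₀, hθ⟩ := exists_threshold hℓ hε (2 * K) W
    (D := 2 * R + 4 * R * (2 * M + 4)) (by positivity)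
  refine ⟨θ₀, hθ₀, fun θ h0 h1 pos hpos => ?_⟩
  obtain ⟨node, hnode, hD⟩ := hpos.exists_blocks hR M
  have hbad : ∀ Q, MeasurableSet[⨆ p ∈ (fun p : {p : ℕ × ℕ // p.1 ≠ p.2} => owner node p.1) ⁻¹' {Q},
      MeasurableSpace.comap (H p) inferInstance]
      {ω | IsBadBlock node ℓ pos (fun p => H p ω) ε K Q} := fun Q =>
    @measurableSet_isBadBlock Ω (⨆ p ∈ (fun p : {p : ℕ × ℕ // p.1 ≠ p.2} => owner node p.1) ⁻¹' {Q},
      MeasurableSpace.comap (H p) inferInstance) M node ℓ pos H hnode Q (fun p hp =>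
        (comap_measurable (H p)).mono
          (le_biSup (fun p => MeasurableSpace.comap (H p) inferInstance) hp) le_rfl) ε K
  have hprob : ∀ Q, P {ω | IsBadBlock node ℓ pos (fun p => H p ω) ε K Q} ≤ 144⁻¹ := fun Q => by
    refine (measure_isBadBlock_le hnode hmeas hind hq hq1 hℓ hpos hC (by positivity) Q).trans
      ((add_le_add hM hK).trans (le_of_eq ?_))
    rw [← two_mul, show (288 : ℝ≥0∞) = 2 * 144 by norm_num,
      ENNReal.mul_inv (by simp) (by simp), ← mul_assoc, ENNReal.mul_inv_cancel (by simp) (by simp),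
      one_mul]
  filter_upwards [ae_eventually_zero_notMem_badBlocks (fun p => (hmeas p).comap_le) hind.iIndep
    hbad hprob] with ω hω
  exact percolates_of_eventually_notMem_badBlocks hnode hM0 hℓ hD (hθ θ h0 h1) hω

end Probability

/-! ### Random node positions -/

theorem measurableSet_percolates {Ω : Type*} [MeasurableSpace Ω] {G : Ω → SimpleGraph ℕ}
    (hG : ∀ m n, MeasurableSet {ω | (G ω).Adj m n}) : MeasurableSet {ω | Percolates (G ω)} := by
  have hwalk : ∀ k m n, MeasurableSet {ω | ∃ w : (G ω).Walk m n, w.length = k} := by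
    intro k
    induction k with
    | zero =>
      intro m n
      have : {ω | ∃ w : (G ω).Walk m n, w.length = 0} = {_ω | m = n} := by
        ext ω
        exact ⟨fun ⟨w, hw⟩ => SimpleGraph.Walk.eq_of_length_eq_zero hw,
          fun h => by obtain rfl : m = n := h; exact ⟨.nil, rfl⟩⟩
      rw [this]
      exact MeasurableSet.const _
    | succ k ih =>
      intro m n
      have : {ω | ∃ w : (G ω).Walk m n, w.length = k + 1}
          = {ω | ∃ j, (G ω).Adj m j ∧ ∃ w : (G ω).Walk j n, w.length = k} := by
        ext ω
        constructor
        · rintro ⟨w, hw⟩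
          cases w with
          | nil => simp at hw
          | cons h w => exact ⟨_, h, w, by simpa using hw⟩
        · rintro ⟨j, h, w, hw⟩
          exact ⟨.cons h w, by simp [hw]⟩
      rw [this]
      exact measurableSet_setOf_exists fun j => (hG m j).inter (ih j n)
  have hset : {ω | Percolates (G ω)}
      = {ω | ∃ x : ℕ, ∀ b : ℕ, ∃ y, ∃ k, (∃ w : (G ω).Walk x y, w.length = k) ∧ b < y} := by
    ext ω
    refine (percolates_iff _).trans (exists_congr fun x => Set.infinite_iff_exists_gt.trans ?_)
    refine forall_congr' fun b => exists_congr fun y => ?_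
    exact ⟨fun ⟨⟨w⟩, h⟩ => ⟨_, ⟨w, rfl⟩, h⟩, fun ⟨_, ⟨w, _⟩, h⟩ => ⟨⟨w⟩, h⟩⟩
  rw [hset]
  exact measurableSet_setOf_exists fun x => measurableSet_setOf_forall fun b =>
    measurableSet_setOf_exists fun y =>
    measurableSet_setOf_exists fun k => (hwalk k x y).inter (MeasurableSet.const _)

theorem measurable_sinr {ℓ : ℝ → ℝ} (hℓ : IsPathLoss ℓ) (W : ℝ≥0) (m n : ℕ) :
    Measurable fun z : (ℕ → Plane) × ({p : ℕ × ℕ // p.1 ≠ p.2} → ℝ≥0) =>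
      sinr ℓ W z.1 (offDiag z.2) m n := by
  -- `ℓ` is only known to be monotone on `[0, ∞)`
  have hℓm : Measurable fun r => ℓ (max r 0) := by
    refine Antitone.measurable fun r s hrs => ?_
    exact hℓ.antitone (le_max_right r 0) (le_max_right s 0) (max_le_max_right 0 hrs)
  have hpower : ∀ m n, Measurable fun z : (ℕ → Plane) × ({p : ℕ × ℕ // p.1 ≠ p.2} → ℝ≥0) =>
      power ℓ z.1 (offDiag z.2) m n := by
    intro m n
    have h1 : Measurable fun z : (ℕ → Plane) × ({p : ℕ × ℕ // p.1 ≠ p.2} → ℝ≥0) =>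
        ENNReal.ofReal (ℓ (dist (z.1 m) (z.1 n))) := by
      have : Measurable fun z : (ℕ → Plane) × ({p : ℕ × ℕ // p.1 ≠ p.2} → ℝ≥0) =>
          ENNReal.ofReal (ℓ (max (dist (z.1 m) (z.1 n)) 0)) :=
        (hℓm.comp (by fun_prop)).ennreal_ofReal
      simpa only [max_eq_left dist_nonneg] using this
    have h2 : Measurable fun z : (ℕ → Plane) × ({p : ℕ × ℕ // p.1 ≠ p.2} → ℝ≥0) =>
        offDiag z.2 m n :=
      measurable_offDiag (H := fun p (z : (ℕ → Plane) × ({p : ℕ × ℕ // p.1 ≠ p.2} → ℝ≥0)) => z.2 p)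
        fun h =>
        (measurable_pi_apply (⟨(m, n), h⟩ : {p : ℕ × ℕ // p.1 ≠ p.2})).comp measurable_snd
    exact h2.coe_nnreal_ennreal.mul h1
  have hinterference : Measurable fun z : (ℕ → Plane) × ({p : ℕ × ℕ // p.1 ≠ p.2} → ℝ≥0) =>
      interference ℓ z.1 (offDiag z.2) m n := Measurable.tsum fun z => hpower z n
  exact (hpower m n).div (hinterference.add measurable_const)

theorem sinrGraph_offDiag (ℓ : ℝ → ℝ) (W : ℝ≥0) (pos : ℕ → Plane) (g : ℕ → ℕ → ℝ≥0) (θ : ℝ) :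
    sinrGraph ℓ W pos (offDiag fun p => g p.1.1 p.1.2) θ = sinrGraph ℓ W pos g θ := by
  have hpow : ∀ {m n}, m ≠ n →
      power ℓ pos (offDiag fun p => g p.1.1 p.1.2) m n = power ℓ pos g m n := fun h => by
    rw [power, power, offDiag_of_ne _ h]
  have hsinr : ∀ {m n}, m ≠ n →
      sinr ℓ W pos (offDiag fun p => g p.1.1 p.1.2) m n = sinr ℓ W pos g m n := fun h => by
    rw [sinr, sinr, hpow h, interference, interference, tsum_congr fun z => hpow z.2.2]
  ext m n
  simp only [sinrGraph]
  refine and_congr_right fun h => ?_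
  rw [hsinr h, hsinr (Ne.symm h)]

theorem IsFading.exists_lt_measure {Ω : Type*} [MeasurableSpace Ω] {P : Measure Ω}
    {X : ℕ → Ω → Plane} {h : ℕ → ℕ → Ω → ℝ≥0} (hh : IsFading P X h) :
    ∃ ε : ℝ≥0, 0 < ε ∧ ∃ q : ℝ≥0∞, q ≠ 0 ∧ ∀ m n, m ≠ n → q ≤ P {ω | ε < h m n ω} := by
  have h1 : ¬ ∀ᵐ ω ∂P, ∀ k : ℕ, h 0 1 ω ≤ ((k : ℝ≥0) + 1)⁻¹ := by
    intro hae
    refine hh.nonzero 0 1 zero_ne_one ?_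
    filter_upwards [hae] with ω hω
    refine le_antisymm ?_ zero_le
    refine le_of_forall_pos_le_add fun ε hε => ?_
    obtain ⟨k, hk⟩ := exists_nat_one_div_lt (NNReal.coe_pos.2 hε)
    have hk' : ((k : ℝ≥0) + 1)⁻¹ ≤ ε := by
      rw [← NNReal.coe_le_coe]; push_cast; rw [← one_div]; exact hk.le
    simpa using (hω k).trans hk'
  rw [ae_all_iff, not_forall] at h1
  obtain ⟨k, hk⟩ := h1
  refine ⟨((k : ℝ≥0) + 1)⁻¹, by positivity, P {ω | ((k : ℝ≥0) + 1)⁻¹ < h 0 1 ω},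
    fun h0 => hk ?_, ?_⟩
  · rw [ae_iff]
    simp only [not_le]
    exact h0
  · intro m n hmn
    exact ((hh.identDistrib 0 1 m n zero_ne_one hmn).measure_mem_eq measurableSet_Ioi).le

theorem IsFading.exists_lintegral_le {Ω : Type*} [MeasurableSpace Ω] {P : Measure Ω}
    {X : ℕ → Ω → Plane} {h : ℕ → ℕ → Ω → ℝ≥0} (hh : IsFading P X h) :
    ∃ C : ℝ≥0∞, C ≠ ∞ ∧ ∀ m n, m ≠ n → ∫⁻ ω, h m n ω ∂P ≤ C := by
  obtain ⟨s₀, hs₀, hexp⟩ := hh.expMoments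
  set s := s₀ / 2 with hs
  have hspos : 0 < s := by positivity
  refine ⟨∫⁻ ω, h 0 1 ω ∂P, ?_, fun m n hmn => ?_⟩
  · have hint := (hexp s ⟨hspos.le, by linarith⟩ 0 1 zero_ne_one).const_mul s⁻¹
    refine ne_top_of_le_ne_top hint.lintegral_lt_top.ne (lintegral_mono fun ω => ?_)
    rw [← ENNReal.ofReal_coe_nnreal]
    refine ENNReal.ofReal_le_ofReal ?_
    rw [inv_mul_eq_div, le_div_iff₀ hspos, mul_comm]
    linarith [Real.add_one_le_exp (s * h 0 1 ω)]
  · have hm : Measurable fun x : ℝ≥0 => (x : ℝ≥0∞) := measurable_coe_nnreal_ennreal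
    exact ((hh.identDistrib m n 0 1 hmn zero_ne_one).comp hm).lintegral_eq.le

/-- Since the fading variables are independent of the positions, it suffices to prove percolation
for almost all fading variables at each fixed regular sequence of positions. -/
theorem exists_threshold_ae_percolates {Ω : Type*} [MeasurableSpace Ω] {P : Measure Ω}
    [IsProbabilityMeasure P] {X : ℕ → Ω → Plane} {h : ℕ → ℕ → Ω → ℝ≥0} (hX : ∀ n, Measurable (X n))
    (hh : IsFading P X h) {N : ℕ} {R : ℝ} (hR : 0 < R)
    (hreg : ∀ᵐ ω ∂P, IsRegular (fun n => X n ω) N R) {ℓ : ℝ → ℝ} (hℓ : IsPathLoss ℓ) (W : ℝ≥0) :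
    ∃ θ₀ : ℝ, 0 < θ₀ ∧ ∀ θ : ℝ, 0 < θ → θ < θ₀ →
      ∀ᵐ ω ∂P, Percolates (sinrGraph ℓ W (fun n => X n ω) (fun m n => h m n ω) θ) := by
  obtain ⟨ε, hε, q, hq0, hq⟩ := hh.exists_lt_measure
  obtain ⟨C, hC0, hC⟩ := hh.exists_lintegral_le
  let H : {p : ℕ × ℕ // p.1 ≠ p.2} → Ω → ℝ≥0 := fun p => h p.1.1 p.1.2
  have hH : ∀ p, Measurable (H p) := fun p => hh.measurable _ _
  obtain ⟨θ₀, hθ₀, hθ⟩ := exists_threshold_forall_ae_percolates (P := P) hH hh.iIndep hε hq0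
    (fun p => hq _ _ p.2) hC0 (fun p => hC _ _ p.2) hℓ W N hR
  refine ⟨θ₀, hθ₀, fun θ h0 h1 => ?_⟩
  let X' : Ω → ℕ → Plane := fun ω n => X n ω
  let H' : Ω → {p : ℕ × ℕ // p.1 ≠ p.2} → ℝ≥0 := fun ω p => H p ω
  have hX' : Measurable X' := measurable_pi_lambda _ hX
  have hH' : Measurable H' := measurable_pi_lambda _ hH
  let E : Set ((ℕ → Plane) × ({p : ℕ × ℕ // p.1 ≠ p.2} → ℝ≥0)) :=
    {z | Percolates (sinrGraph ℓ W z.1 (offDiag z.2) θ)}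
  have hE : MeasurableSet E := by
    refine measurableSet_percolates fun m n => ?_
    exact (MeasurableSet.const _).inter
      ((measurableSet_lt measurable_const (measurable_sinr hℓ W m n)).inter
        (measurableSet_lt measurable_const (measurable_sinr hℓ W n m)))
  have hmap : P.map (fun ω => (X' ω, H' ω)) = (P.map X').prod (P.map H') :=
    (indepFun_iff_map_prod_eq_prod_map_map hX'.aemeasurable hH'.aemeasurable).1 hh.indep
  have := Measure.isProbabilityMeasure_map (μ := P) hH'.aemeasurable
  have hae : ∀ᵐ z ∂(P.map fun ω => (X' ω, H' ω)), z ∈ E := by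
    have hsec : MeasurableSet {x | ∀ᵐ y ∂(P.map H'), (x, y) ∈ E} :=
      measurableSet_eq_fun (measurable_measure_prodMk_left hE.compl) measurable_const
    rw [hmap, Measure.ae_prod_mem_iff_ae_ae_mem hE, ae_map_iff hX'.aemeasurable hsec]
    filter_upwards [hreg] with ω hω
    rw [ae_map_iff hH'.aemeasurable (measurable_prodMk_left hE)]
    exact hθ θ h0 h1 _ hω
  filter_upwards [(ae_map_iff (hX'.prodMk hH').aemeasurable hE).1 hae] with ω hω
  rwa [← sinrGraph_offDiag]

/-- An enumeration of the points of a regular configuration is a regular family. -/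
theorem IsEnumeration.ae_isRegular {Ω : Type*} [MeasurableSpace Ω] {P : Measure Ω}
    {Φ : Ω → Config} {X : ℕ → Ω → Plane} (hX : IsEnumeration P Φ X) {N : ℕ} {t : ℝ}
    (hreg : ∀ᵐ ω ∂P, Φ ω ∈ regularConfigs N t) :
    ∀ᵐ ω ∂P, IsRegular (fun n => X n ω) N (t + 1) := by
  filter_upwards [hreg, hX.injective, hX.range_eq] with ω h hinj hrange
  have hmem : ∀ n, X n ω ∈ (Φ ω).points := fun n => hrange ▸ Set.mem_range_self n
  refine (isRegular_of_mem_regularConfigs h).of_bijective (f := fun n => ⟨X n ω, hmem n⟩) (t := 0)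
    ⟨fun m n hmn => hinj (congrArg Subtype.val hmn), fun x => ?_⟩ (fun n => by simp)
  obtain ⟨n, hn⟩ : (x : Plane) ∈ Set.range fun n => X n ω := by
    rw [hrange]; exact x.2
  exact ⟨n, Subtype.ext hn⟩

end SpatialNetwork

open SpatialNetwork in
theorem mainTheorem11 {Ω : Type*} [MeasurableSpace Ω] (P : Measure Ω) [IsProbabilityMeasure P]
    (Φ : Ω → Config) (hΦ : IsPointProcess Φ) (hstat : IsStationary P Φ)
    (σ ρ ν τ : ℝ) (hball : StronglyBallRegulated P Φ σ ρ ν) (hvoid : StronglyVoidRegulated P Φ τ)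
    (ℓ : ℝ → ℝ) (hℓ : IsPathLoss ℓ) (W : ℝ≥0) :
    -- without fading
    (∃ θ₀ : ℝ, 0 < θ₀ ∧ ∀ θ : ℝ, 0 < θ → θ < θ₀ → HasBackbone (P.map Φ) ℓ W θ) ∧
    -- with fading
    (∀ (X : ℕ → Ω → Plane) (h : ℕ → ℕ → Ω → ℝ≥0), IsEnumeration P Φ X → IsFading P X h →
      ∃ θ₀ : ℝ, 0 < θ₀ ∧ ∀ θ : ℝ, 0 < θ → θ < θ₀ →
        ∀ᵐ ω ∂P, Percolates
          (sinrGraph ℓ W (fun n => X n ω) (fun m n => h m n ω) θ)) := by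
  have hΦ' : Measurable Φ := hΦ
  have hreg := ae_mem_regularConfigs hΦ hstat hball hvoid
  refine ⟨hasBackbone_of_ae_mem_regularConfigs hvoid.1
    ((ae_map_iff hΦ'.aemeasurable (measurableSet_regularConfigs _ _)).2 hreg) hℓ W, ?_⟩
  intro X h hX hh
  exact exists_threshold_ae_percolates hX.measurable hh (add_pos hvoid.1 one_pos)
    (hX.ae_isRegular hreg) hℓ W
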